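/- Setting. For an integer $L\ge 0$ let $\mathcal H$ be the fermionic Fock space with $L$ modes (dimension $2^L$), with annihilation operators $c_1,\dots,c_L$. Its phase space is $\mathcal Y=\mathbb C^{L}\oplus\mathbb C^{L}$ with canonical basis $e_1,\dots,e_{2L}$, the field operators are $\varphi(e_i)=c_i^*$, $\varphi(e_{L+i})=c_i$ ($i\le L$), and $\xi$ is the anti-linear involution $\xi(x\oplus \bar y)=y\oplus\bar x$. For an operator $T$ on $\mathcal Y$ put $d\Gamma(T)=\frac12\sum_{k,l}T_{kl}\,\varphi(e_k)\varphi(e_l)^*$. A thermal quasi-free fermionic model with $n$ baths consists of a system $S$ with $L_S$ modes, baths $B_1,\dots,B_n$ with $L_{B_1},\dots,L_{B_n}$ modes, inverse temperatures $\beta_1,\dots,\beta_n\in\mathbb R$, self-adjoint operators $T_S,\kappa_S$ on $\mathcal Y_S$ and $\kappa_i$ on $\mathcal Y_{B_i}$, and linear maps $\Theta_i:\mathcal Y_{B_i}\to\mathcal Y_S$, such that $\xi T_S\xi=-T_S$, $\xi\kappa_S\xi=-\kappa_S$, $\xi\kappa_i\xi=-\kappa_i$, $\xi\Theta_i\xi=-\Theta_i$,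 $[T_S,\kappa_S]=0$ and $\Theta_i\kappa_i=\kappa_S\Theta_i$ for all $i$. Put $H_S=d\Gamma(T_S)$, $K_S=d\Gamma(\kappa_S)$, $K_{B_i}=d\Gamma(\kappa_i)$. Let $\mathcal H_B$ be the Fock space over all the bath modes, let $\rho_B$ be the product of the Gibbs states $e^{-\beta_iK_{B_i}}/\mathrm{Tr}\,e^{-\beta_iK_{B_i}}$, and let $$H_{SB_i}=\sum_{k,l}(\Theta_i)_{kl}\,\varphi_S(e_k)\,\varphi_{B_i}(e_l)^*,\qquad H_{SB}=\sum_{i=1}^nH_{SB_i}$$ on $\mathcal H_S\otimes\mathcal H_B$, where $\varphi_S$ acts as $\varphi_S\otimes(-1)^{N_B}$ ($N_B$ the number operator of the bath) and $\varphi_{B_i}$ as $\mathbb 1\otimes\varphi_{B_i}$. For an operator $V$ on $\mathcal H_S\otimes\mathcal H_B$ let $\Phi_V(A)=\mathrm{Tr}_B\big(V(A\otimes\mathbb 1)V(\mathbb 1\otimes\rho_B)\big)$ and $\mathcal D_V(A)=\Phi_V(A)-\frac12\{\Phi_V(\mathbb 1),A\}$. The quantum Markov semigroup (QMS) of the model has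 generator, in the Heisenberg picture, $$\mathcal L(A)=i[H_S,A]+\mathcal D_{H_{SB}}(A).$$ A stationary state is a density matrix $\rho$ on $\mathcal H_S$ with $\mathcal L^*(\rho)=0$. The energy flux entering the $i$-th bath in the state $\rho$ is $J_i(\rho)=-\mathrm{Tr}(\rho\,\mathcal L_i(K_S))$, where $\mathcal L_i=\mathcal D_{H_{SB_i}}$. Theorem. Let $\rho_\infty$ be any stationary state of a thermal quasi-free fermionic QMS and let $J_i=J_i(\rho_\infty)$. Then the $J_i$ are real, and there is a family of real numbers $(J_{i,j})_{1\le i,j\le n}$ with $$J_{j,i}=-J_{i,j}\ \text{ for all } i,j,\qquad J_{i,j}\ge 0\ \text{ whenever }\beta_i\ge\beta_j,\qquad J_i=\sum_{j=1}^nJ_{i,j}\ \text{ for all } i.$$ In particular $\sum_iJ_i=0$; if $\beta_1\le\dots\le\beta_n$, then $\sum_{i\le k}J_i\le 0$ for every $k\le n$; and $J_i\ge0$ for every bath $i$ of maximal inverse temperature, so energy is never pumped out of the coldest bath ("no fridge"). Moreover the two forms are equivalent: for real numbers $(J_i)_{1\le i\le n}$ with $\sum_iJ_i=0$, a family $(J_{i,j})$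 with the three properties above exists if and only if $\sum_{i\le k}J_{\sigma(i)}\le 0$ for every $k$ and every permutation $\sigma$ of the baths with $\beta_{\sigma(1)}\le\dots\le\beta_{\sigma(n)}$ (when the $\beta_i$ are distinct there is only one such $\sigma$). -/

import Mathlib

open scoped Matrix Kronecker ComplexOrder

noncomputable section

namespace QuasiFree

/-- Operators on the fermionic Fock space over the one-particle space with orthonormal basis `ι`,
as matrices in the occupation number basis `|u⟩`, `u : ι → Bool`. -/
abbrev FockOp (ι : Type*) := Matrix (ι → Bool) (ι → Bool) ℂ

/-- Operators between phase spaces `𝒴 = ℋ₀ ⊕ conj ℋ₀`, as matrices in the creation/annihilation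
bases `e`; `Sum.inl i` is the index of `|i⟩ ⊕ 0` and `Sum.inr i` that of `0 ⊕ s|i⟩`. -/
abbrev PhaseOp (ι κ : Type*) := Matrix (ι ⊕ ι) (κ ⊕ κ) ℂ

section Fock

variable {ι : Type*} [Fintype ι] [LinearOrder ι]

/-- The annihilation operator `c_i`:
`c_i |u⟩ = (-1)^{∑_{j<i} u_j} |u with u_i replaced by 0⟩` if `u_i = 1`, and `c_i |u⟩ = 0` if
`u_i = 0`. -/
def annihilation (i : ι) : FockOp ι :=
  Matrix.of fun v u =>
    if u i = true ∧ v = Function.update u i false then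
      (-1 : ℂ) ^ (Finset.univ.filter fun j => j < i ∧ u j = true).card
    else 0

/-- The parity operator `(-1)^N`, with `N = ∑ c_i^* c_i` the number operator. -/
def parity (ι : Type*) [Fintype ι] : FockOp ι :=
  Matrix.diagonal fun u => (-1 : ℂ) ^ (Finset.univ.filter fun j => u j = true).card

/-- The field operators `φ(e_k)` on the creation/annihilation basis of the phase space. -/
def field : ι ⊕ ι → FockOp ι
  | Sum.inl i => (annihilation i)ᴴ
  | Sum.inr i => annihilation i

/-- The quadratic operator `dΓ(T) = ½ F^* T F = ½ ∑_{k,l} T_{kl} φ(e_k) φ(e_l)^*`. -/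
def quadratic (T : PhaseOp ι ι) : FockOp ι :=
  (1 / 2 : ℂ) • ∑ k, ∑ l, T k l • (field k * (field l)ᴴ)

/-- The anti-linear involution `ξ (x ⊕ s y) = y ⊕ s x` of the phase space. -/
def xi {ι : Type*} (x : ι ⊕ ι → ℂ) : ι ⊕ ι → ℂ := fun k => star (x k.swap)

/-- The condition `ξ Θ ξ = -Θ` on an operator between phase spaces. -/
def XiAnti {ι κ : Type*} [Fintype κ] (Θ : PhaseOp ι κ) : Prop :=
  ∀ x : κ ⊕ κ → ℂ, xi (Θ *ᵥ xi x) = -(Θ *ᵥ x)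

end Fock

/-- Partial trace of an operator on a tensor product over the second factor. -/
def partialTrace {a b : Type*} [Fintype b] (X : Matrix (a × b) (a × b) ℂ) : Matrix a a ℂ :=
  Matrix.of fun u v => ∑ w, X (u, w) (v, w)

/-- The Gibbs state `e^{-K} / Tr e^{-K}`. -/
def gibbs {a : Type*} [Fintype a] [DecidableEq a] (K : Matrix a a ℂ) : Matrix a a ℂ :=
  (NormedSpace.exp (-K)).trace⁻¹ • NormedSpace.exp (-K)

/-- A density matrix. -/
def IsState {a : Type*} [Fintype a] (ρ : Matrix a a ℂ) : Prop :=
  ρ.PosSemidef ∧ ρ.trace = 1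

/-- The data of a thermal quasi-free fermionic repeated interaction model with `n` baths. -/
structure ThermalModel (n : ℕ) where
  /-- number of modes of the system -/
  LS : ℕ
  /-- number of modes of each bath -/
  LB : Fin n → ℕ
  /-- one-particle form of the Hamiltonian of the system -/
  TS : PhaseOp (Fin LS) (Fin LS)
  /-- coupling of the system to each bath -/
  Θ : (i : Fin n) → PhaseOp (Fin LS) (Fin (LB i))
  /-- one-particle form of the pseudo-energy of the system -/
  κS : PhaseOp (Fin LS) (Fin LS)
  /-- one-particle form of the pseudo-energy of each bath -/
  κB : (i : Fin n) → PhaseOp (Fin (LB i)) (Fin (LB i))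
  /-- inverse temperatures of the baths -/
  β : Fin n → ℝ
  TS_herm : TS.IsHermitian
  TS_xi : XiAnti TS
  Θ_xi : ∀ i, XiAnti (Θ i)
  κS_herm : κS.IsHermitian
  κS_xi : XiAnti κS
  κB_herm : ∀ i, (κB i).IsHermitian
  κB_xi : ∀ i, XiAnti (κB i)
  /-- conservation of the pseudo-energy by the Hamiltonian of the system: `[T_S, κ_S] = 0` -/
  conserved_S : TS * κS = κS * TS
  /-- conservation of the pseudo-energy by the interaction: `Θ_i κ_i = κ_S Θ_i` -/
  conserved_SB : ∀ i, Θ i * κB i = κS * Θ i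

namespace ThermalModel

variable {n : ℕ} (m : ThermalModel n)

/-- The modes of the total bath, whose one-particle space is `⨁ i, ℋ_{B_i,0}`: bath after bath. -/
abbrev BathMode := Σₗ i : Fin n, Fin (m.LB i)

/-- Inclusion of the phase space basis of the bath `i` in that of the total bath. -/
def bathIndex (i : Fin n) : Fin (m.LB i) ⊕ Fin (m.LB i) → m.BathMode ⊕ m.BathMode :=
  Sum.map (fun a => toLex ⟨i, a⟩) (fun a => toLex ⟨i, a⟩)

/-- Operators on the Hilbert space of the system. -/
abbrev SysOp := FockOp (Fin m.LS)

/-- Operators on `ℋ_S ⊗ ℋ_B`. -/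
abbrev TotOp :=
  Matrix ((Fin m.LS → Bool) × (m.BathMode → Bool)) ((Fin m.LS → Bool) × (m.BathMode → Bool)) ℂ

/-- The Hamiltonian of the system, `H_S = ½ F_S^* T_S F_S`. -/
def HS : m.SysOp := quadratic m.TS

/-- The pseudo-energy of the system, `K_S = ½ F_S^* κ_S F_S`. -/
def KS : m.SysOp := quadratic m.κS

/-- The pseudo-energy of the bath `i`, `K_{B_i} = ½ F_{B_i}^* κ_i F_{B_i}`. -/
def KB (i : Fin n) : FockOp m.BathMode :=
  (1 / 2 : ℂ) • ∑ k, ∑ l,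
    m.κB i k l • (field (m.bathIndex i k) * (field (m.bathIndex i l))ᴴ)

/-- The state of the baths: the product of the (commuting) Gibbs states `e^{-β_i K_{B_i}} / Z_i`,
that is `e^{-∑ β_i K_{B_i}} / Z`. -/
def ρB : FockOp m.BathMode := gibbs (∑ i, (m.β i : ℂ) • m.KB i)

/-- Field operators of the system on `ℋ_S ⊗ ℋ_B`: under the identification of `ℋ_S ⊗ ℋ_B` with the
Fock space of `ℋ_{S,0} ⊕ ℋ_{B,0}` (modes of the bath first) they carry the parity of the bath. -/
def fieldS (k : Fin m.LS ⊕ Fin m.LS) : m.TotOp := field k ⊗ₖ parity m.BathMode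

/-- Field operators of the bath on `ℋ_S ⊗ ℋ_B`. -/
def fieldB (l : m.BathMode ⊕ m.BathMode) : m.TotOp := (1 : m.SysOp) ⊗ₖ field l

/-- The interaction with the bath `i`,
`H_{SB_i} = F_S^* Θ_i F_{B_i} = ∑_{k,l} (Θ_i)_{kl} φ_S(e_k) φ_B(e_l)^*`. -/
def HSB (i : Fin n) : m.TotOp :=
  ∑ k, ∑ l, m.Θ i k l • (m.fieldS k * (m.fieldB (m.bathIndex i l))ᴴ)

/-- The completely positive map `A ↦ Tr_B (V (A ⊗ 1) V (1 ⊗ ρ_B))` of an interaction `V`. -/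
def Φ (V : m.TotOp) (A : m.SysOp) : m.SysOp :=
  partialTrace (V * (A ⊗ₖ (1 : FockOp m.BathMode)) * V * ((1 : m.SysOp) ⊗ₖ m.ρB))

/-- The dissipative part `A ↦ Φ(A) - ½ {Φ(1), A}` of the generator (Heisenberg picture). -/
def dissipator (V : m.TotOp) (A : m.SysOp) : m.SysOp :=
  m.Φ V A - (1 / 2 : ℂ) • (m.Φ V 1 * A + A * m.Φ V 1)

/-- The generator `ℒ(A) = i[H_S, A] + Φ(A) - ½ {Φ(1), A}` of the quantum Markov semigroup
(Heisenberg picture), for the total interaction `H_{SB} = ∑ H_{SB_i}`. -/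
def generator (A : m.SysOp) : m.SysOp :=
  Complex.I • (m.HS * A - A * m.HS) + m.dissipator (∑ i, m.HSB i) A

/-- A state `ρ` is stationary if `ℒ^*(ρ) = 0`, i.e. `Tr (ρ ℒ(A)) = 0` for all `A`. -/
def IsStationaryState (ρ : m.SysOp) : Prop :=
  IsState ρ ∧ ∀ A : m.SysOp, (ρ * m.generator A).trace = 0

/-- The energy flux `J_i(ρ) = -Tr (ρ ℒ_i(K_S))` entering the bath `i`, where
`ℒ_i(A) = Φ_i(A) - ½ {Φ_i(1), A}` is the dissipator of the interaction with the bath `i`. -/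
def flux (ρ : m.SysOp) (i : Fin n) : ℂ :=
  -(ρ * m.dissipator (m.HSB i) m.KS).trace

end ThermalModel

/-- `P i j` is a decomposition of the fluxes `J i` into fluxes between pairs of baths, each of them
from the hotter bath to the colder one: `P i j` is what the bath `i` receives from the bath `j`. -/
def IsPairDecomposition {n : ℕ} (β J : Fin n → ℝ) (P : Fin n → Fin n → ℝ) : Prop :=
  (∀ i j, P j i = -P i j) ∧ (∀ i j, β j ≤ β i → 0 ≤ P i j) ∧ ∀ i, J i = ∑ j, P i j

end QuasiFree

end

/-! Everything reduces to the two-point matrix R of the stationary state. Testing stationarity on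
quadratic observables alone gives a closed Lyapunov equation (`covariance_lyapunov`): ½{∑ D_i, R} +
i[T, R] = ∑ G_i, with D_i = Θ_i Θ_i^* and G_i (1 + e^{-β_i κ}) = D_i. The Fermi-Dirac factor comes
from the KMS property of the bath state (`gibbs_quadratic`), carried to the system by Θ_i κ_i = κ_S
Θ_i. The fluxes become J_i = ½ (tr κG_i - ½ tr D_i {κ, R}) (`flux_eq`). They sum to zero because κ
commutes with T and every D_i.

For the second law, take a set A of baths with β_i ≤ b on A and β_i ≥ b off A. Put F_β = κ / (1 +
e^{-βκ}) and W = ½{κ, R} - F_b. Then W solves the same Lyapunov equation with sources N_i = D_i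
(F_{β_i} - F_b). Since F_β increases with β, N_i ≤ 0 on A and N_i ≥ 0 off A. Pairing the equation
with the negative spectral projection Q of W gives ∑ tr D_i QW = ∑ tr QN_i. The sign conditions then
give ∑_{i ∈ A} (tr N_i - tr D_i W) ≤ 0 (`lyapunov_sum_nonpos`), and the left side is 2 ∑_{i ∈ A}
J_i.

The rest is combinatorial: fluxes of zero sum for which all hot sets lose energy split into
hot-to-cold transfers by a greedy matching (`HotSetsLose.exists_isPairDecomposition`). The hot sets
are exactly the initial segments of the orderings compatible with β. -/

noncomputable section

namespace QuasiFree

/-! ### Jordan-Wigner signs and the canonical anticommutation relations. -/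

section CAR

variable {ι : Type*} [Fintype ι] [LinearOrder ι]

/-- The Jordan-Wigner sign of the mode `i` in the configuration `u`. -/
def jwSign (i : ι) (u : ι → Bool) : ℂ :=
  (-1 : ℂ) ^ (Finset.univ.filter fun j => j < i ∧ u j = true).card

/-- The ladder operator which moves the mode `i` from the occupation `b` to the occupation `!b`. -/
def ladder (i : ι) (b : Bool) : FockOp ι :=
  Matrix.of fun v u => if u i = b ∧ v = Function.update u i (!b) then jwSign i u else 0

lemma jwSign_eq_prod (i : ι) (u : ι → Bool) :
    jwSign i u = ∏ j, if j < i ∧ u j = true then (-1 : ℂ) else 1 := by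
  rw [jwSign, Finset.prod_ite]; simp

lemma jwSign_update_of_not_lt {i j : ι} (h : ¬ j < i) (u : ι → Bool) (b : Bool) :
    jwSign i (Function.update u j b) = jwSign i u := by
  simp only [jwSign]
  congr 2
  ext x
  simp only [Finset.mem_filter, Finset.mem_univ, true_and]
  by_cases hx : x = j
  · subst hx; simp [h]
  · simp [Function.update_of_ne hx]

/-- Only the factor of the mode `j` changes in the product form of the sign; this is the source of
anticommutation. -/
lemma jwSign_update_of_lt {i j : ι} (h : j < i) (u : ι → Bool) :
    jwSign i (Function.update u j (!(u j))) = -jwSign i u := by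
  simp only [jwSign_eq_prod]
  rw [← Finset.mul_prod_erase _ _ (Finset.mem_univ j),
    ← Finset.mul_prod_erase Finset.univ (fun x => if x < i ∧ u x = true then (-1 : ℂ) else 1)
      (Finset.mem_univ j)]
  have : ∏ x ∈ Finset.univ.erase j,
      (if x < i ∧ Function.update u j (!(u j)) x = true then (-1 : ℂ) else 1) =
      ∏ x ∈ Finset.univ.erase j, (if x < i ∧ u x = true then (-1 : ℂ) else 1) := by
    refine Finset.prod_congr rfl fun x hx => ?_
    rw [Function.update_of_ne (Finset.ne_of_mem_erase hx)]
  rw [this]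
  cases hj : u j <;> simp [h]

lemma jwSign_mul_self (i : ι) (u : ι → Bool) : jwSign i u * jwSign i u = 1 := by
  rw [jwSign, ← mul_pow]; simp

lemma star_jwSign (i : ι) (u : ι → Bool) : star (jwSign i u) = jwSign i u := by
  simp [jwSign]

lemma annihilation_eq_ladder (i : ι) : annihilation i = ladder i true := rfl

lemma ladder_conjTranspose (i : ι) (b : Bool) : (ladder i b)ᴴ = ladder i (!b) := by
  ext v u
  simp only [ladder, Matrix.conjTranspose_apply, Matrix.of_apply]
  have h : (v i = b ∧ u = Function.update v i (!b)) ↔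
      (u i = !b ∧ v = Function.update u i (!!b)) := by
    constructor
    · rintro ⟨rfl, rfl⟩; simp
    · rintro ⟨h, rfl⟩; simp [← h]
  by_cases hc : u i = !b ∧ v = Function.update u i (!!b)
  · rw [if_pos hc, if_pos (h.2 hc), hc.2, jwSign_update_of_not_lt (lt_irrefl i), star_jwSign]
  · rw [if_neg hc, if_neg (fun h' => hc (h.1 h'))]; simp

lemma mul_ladder_apply (A : FockOp ι) (i : ι) (b : Bool) (v u : ι → Bool) :
    (A * ladder i b) v u = if u i = b then A v (Function.update u i (!b)) * jwSign i u else 0 := by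
  rw [Matrix.mul_apply]
  by_cases h : u i = b
  · simp [ladder, h]
  · simp [ladder, h]

lemma ladder_mul_ladder_apply (i j : ι) (b c : Bool) (v u : ι → Bool) :
    (ladder i b * ladder j c) v u =
      if u j = c ∧ Function.update u j (!c) i = b ∧
        v = Function.update (Function.update u j (!c)) i (!b) then
        jwSign i (Function.update u j (!c)) * jwSign j u else 0 := by
  rw [mul_ladder_apply]
  simp only [ladder, Matrix.of_apply, ite_and, ite_mul, zero_mul]

/-- The two orders of moves reach the same configuration. For `i < j`, the sign of `j` sees the flip
of `i` but not conversely, hence one relative minus. -/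
lemma ladder_anticomm_of_ne {i j : ι} (hij : i ≠ j) (b c : Bool) :
    ladder i b * ladder j c + ladder j c * ladder i b = 0 := by
  wlog hlt : i < j generalizing i j b c
  · rw [add_comm]
    exact this hij.symm c b (lt_of_le_of_ne (not_lt.1 hlt) hij.symm)
  ext v u
  rw [Matrix.add_apply, ladder_mul_ladder_apply, ladder_mul_ladder_apply,
    Function.update_of_ne hij, Function.update_of_ne hij.symm, Function.update_comm hij.symm]
  by_cases h : u j = c ∧ u i = b ∧ v = Function.update (Function.update u i (!b)) j (!c)
  · have h' : u i = b ∧ u j = c ∧ v = Function.update (Function.update u i (!b)) j (!c) := by tauto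
    rw [if_pos h, if_pos h', jwSign_update_of_not_lt hlt.not_gt, ← h.2.1,
      jwSign_update_of_lt hlt]
    simp; ring
  · have h' : ¬ (u i = b ∧ u j = c ∧ v = Function.update (Function.update u i (!b)) j (!c)) := by
      tauto
    rw [if_neg h, if_neg h']; simp

lemma ladder_mul_self (i : ι) (b : Bool) : ladder i b * ladder i b = 0 := by
  ext v u
  rw [ladder_mul_ladder_apply]; simp

lemma ladder_anticomm_not (i : ι) (b : Bool) :
    ladder i b * ladder i (!b) + ladder i (!b) * ladder i b = 1 := by
  ext v u
  rw [Matrix.add_apply, ladder_mul_ladder_apply, ladder_mul_ladder_apply, Matrix.one_apply]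
  simp only [jwSign_update_of_not_lt (lt_irrefl i), jwSign_mul_self, Function.update_self,
    Function.update_idem, Bool.not_not, true_and]
  cases hb : u i <;> cases b <;> simp <;> simp [← hb]

/-- The canonical anticommutation relations. -/
lemma field_anticomm [dec : DecidableEq ι] (k l : ι ⊕ ι) :
    field k * field l + field l * field k = if k = l.swap then (1 : FockOp ι) else 0 := by
  obtain rfl : dec = LinearOrder.toDecidableEq := Subsingleton.elim _ _
  have key : ∀ (i j : ι) (b c : Bool), ladder i b * ladder j c + ladder j c * ladder i b =
      if i = j ∧ b = !c then (1 : FockOp ι) else 0 := by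
    intro i j b c
    by_cases hij : i = j
    · subst hij
      by_cases hbc : b = !c
      · subst hbc; simpa [add_comm] using ladder_anticomm_not i c
      · have : b = c := by cases b <;> cases c <;> simp_all
        subst this; simp [ladder_mul_self]
    · simp [hij, ladder_anticomm_of_ne hij]
  rcases k with i | i <;> rcases l with j | j <;>
    simp [field, annihilation_eq_ladder, ladder_conjTranspose, key]

lemma field_conjTranspose (k : ι ⊕ ι) : (field k)ᴴ = field k.swap := by
  rcases k with i | i <;> simp [field]

lemma parity_mul_parity [dec : DecidableEq ι] : parity ι * parity ι = 1 := by
  obtain rfl : dec = LinearOrder.toDecidableEq := Subsingleton.elim _ _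
  rw [parity, Matrix.diagonal_mul_diagonal, ← Matrix.diagonal_one]
  congr 1; ext u
  rw [← mul_pow]; simp

lemma parity_mul_field [dec : DecidableEq ι] (k : ι ⊕ ι) :
    parity ι * field k = -(field k * parity ι) := by
  obtain rfl : dec = LinearOrder.toDecidableEq := Subsingleton.elim _ _
  have key : ∀ (i : ι) (b : Bool), parity ι * ladder i b = -(ladder i b * parity ι) := by
    intro i b
    ext v u
    rw [parity, Matrix.neg_apply, Matrix.diagonal_mul, Matrix.mul_diagonal]
    simp only [ladder, Matrix.of_apply]
    split_ifs with h
    · obtain ⟨hb, rfl⟩ := h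
      have e : ∀ w : ι → Bool, (-1 : ℂ) ^ (Finset.univ.filter fun j => w j = true).card =
          ∏ j, if w j = true then (-1 : ℂ) else 1 := by
        intro w; rw [Finset.prod_ite]; simp
      have : (-1 : ℂ) ^ (Finset.univ.filter
          fun j => Function.update u i (!b) j = true).card =
          - (-1 : ℂ) ^ (Finset.univ.filter fun j => u j = true).card := by
        rw [e, e, ← Finset.mul_prod_erase _ _ (Finset.mem_univ i),
          ← Finset.mul_prod_erase Finset.univ (fun x => if u x = true then (-1 : ℂ) else 1)
            (Finset.mem_univ i)]
        have : ∏ x ∈ Finset.univ.erase i,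
            (if Function.update u i (!b) x = true then (-1 : ℂ) else 1) =
            ∏ x ∈ Finset.univ.erase i, (if u x = true then (-1 : ℂ) else 1) := by
          refine Finset.prod_congr rfl fun x hx => ?_
          rw [Function.update_of_ne (Finset.ne_of_mem_erase hx)]
        rw [this]
        subst hb
        cases u i <;> simp
      rw [this]; ring
    · simp
  rcases k with i | i <;> simp [field, annihilation_eq_ladder, ladder_conjTranspose, key]

end CAR

/-! ### Matrix exponentials and intertwining. -/

section Exponential

open NormedSpace

open scoped Matrix.Norms.L2Operator in
lemma hasSum_matrix_exp {a : Type*} [Fintype a] [DecidableEq a] (A : Matrix a a ℂ) :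
    HasSum (fun n : ℕ => ((n.factorial : ℂ)⁻¹) • A ^ n) (exp A) :=
  exp_series_hasSum_exp' (𝕂 := ℂ) A

/-- The matrix exponential preserves intertwining relations. -/
lemma exp_mul_eq_mul_exp {a b : Type*} [Fintype a] [DecidableEq a] [Fintype b] [DecidableEq b]
    {A : Matrix a a ℂ} {B : Matrix b b ℂ} {F : Matrix a b ℂ} (h : A * F = F * B) :
    exp A * F = F * exp B := by
  have hpow : ∀ n : ℕ, A ^ n * F = F * B ^ n := by
    intro n
    induction n with
    | zero => simp
    | succ n ih => rw [pow_succ, pow_succ, Matrix.mul_assoc, h, ← Matrix.mul_assoc, ih,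
        Matrix.mul_assoc]
  have h1 := (hasSum_matrix_exp A).map (Matrix.addMonoidHomMulRight F)
    (by exact continuous_id.matrix_mul continuous_const)
  have h2 := (hasSum_matrix_exp B).map (Matrix.addMonoidHomMulLeft F)
    (by exact continuous_const.matrix_mul continuous_id)
  refine h1.unique ?_
  convert! h2 using 1
  ext1 n
  simp [hpow]

open scoped Matrix.Norms.L2Operator in
lemma exp_kronecker_one {a b : Type*} [Fintype a] [DecidableEq a] [Fintype b] [DecidableEq b]
    (A : Matrix a a ℂ) : exp (A ⊗ₖ (1 : Matrix b b ℂ)) = exp A ⊗ₖ (1 : Matrix b b ℂ) := by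
  let f : Matrix a a ℂ →+* Matrix (a × b) (a × b) ℂ :=
    { toFun := fun X => X ⊗ₖ (1 : Matrix b b ℂ)
      map_one' := Matrix.one_kronecker_one
      map_mul' := fun X Y => by rw [← Matrix.mul_kronecker_mul, one_mul]
      map_zero' := Matrix.zero_kronecker _
      map_add' := fun X Y => Matrix.add_kronecker _ _ _ }
  let : NormedAlgebra ℚ (Matrix a a ℂ) := NormedAlgebra.restrictScalars ℚ ℂ _
  refine (map_exp f ?_ A).symm
  refine continuous_pi fun i => continuous_pi fun j => ?_
  exact (continuous_id.matrix_elem i.1 j.1).mul continuous_const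

open scoped Matrix.Norms.L2Operator in
lemma exp_one_kronecker {a b : Type*} [Fintype a] [DecidableEq a] [Fintype b] [DecidableEq b]
    (B : Matrix b b ℂ) : exp ((1 : Matrix a a ℂ) ⊗ₖ B) = (1 : Matrix a a ℂ) ⊗ₖ exp B := by
  let f : Matrix b b ℂ →+* Matrix (a × b) (a × b) ℂ :=
    { toFun := fun X => (1 : Matrix a a ℂ) ⊗ₖ X
      map_one' := Matrix.one_kronecker_one
      map_mul' := fun X Y => by rw [← Matrix.mul_kronecker_mul, one_mul]
      map_zero' := Matrix.kronecker_zero _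
      map_add' := fun X Y => Matrix.kronecker_add _ _ _ }
  let : NormedAlgebra ℚ (Matrix b b ℂ) := NormedAlgebra.restrictScalars ℚ ℂ _
  refine (map_exp f ?_ B).symm
  refine continuous_pi fun i => continuous_pi fun j => ?_
  exact continuous_const.mul (continuous_id.matrix_elem i.2 j.2)

lemma exp_kroneckerSum {a b : Type*} [Fintype a] [DecidableEq a] [Fintype b] [DecidableEq b]
    (A : Matrix a a ℂ) (B : Matrix b b ℂ) :
    exp (A ⊗ₖ (1 : Matrix b b ℂ) + (1 : Matrix a a ℂ) ⊗ₖ B) = exp A ⊗ₖ exp B := by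
  rw [Matrix.exp_add_of_commute, exp_kronecker_one, exp_one_kronecker,
    ← Matrix.mul_kronecker_mul, one_mul, mul_one]
  rw [commute_iff_eq, ← Matrix.mul_kronecker_mul, ← Matrix.mul_kronecker_mul]
  simp

/-- If the commutators of `K` with the operators `f k` are given by the matrix `κ`, then the
conjugation of `f k` by `exp K` is given by `exp κ`. -/
lemma exp_mul_of_commutator {a b : Type*} [Fintype a] [DecidableEq a] [Fintype b] [DecidableEq b]
    {K : Matrix a a ℂ} {κ : Matrix b b ℂ} {f : b → Matrix a a ℂ}
    (h : ∀ l, K * f l = f l * K + ∑ k, κ k l • f k) (l : b) :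
    exp K * f l = ∑ k, exp κ k l • (f k * exp K) := by
  -- With the operators `f k` placed side by side in one block row, the commutation relations become
  -- a single intertwining relation with a Kronecker sum.
  let F : Matrix a (a × b) ℂ := Matrix.of fun v p => f p.2 v p.1
  have hF : ∀ (A : Matrix a a ℂ) (B : Matrix b b ℂ) v u l,
      (F * (A ⊗ₖ B)) v (u, l) = (∑ k, B k l • (f k * A)) v u := by
    intro A B v u l
    simp only [F, Matrix.mul_apply, Matrix.of_apply, Matrix.kronecker_apply, Matrix.sum_apply,
      Matrix.smul_apply, smul_eq_mul, Fintype.sum_prod_type, Finset.mul_sum]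
    rw [Finset.sum_comm]
    exact Finset.sum_congr rfl fun _ _ => Finset.sum_congr rfl fun _ _ => by ring
  have hK : K * F = F * (K ⊗ₖ (1 : Matrix b b ℂ) + (1 : Matrix a a ℂ) ⊗ₖ κ) := by
    ext v ⟨u, l⟩
    have h1 : (K * F) v (u, l) = (K * f l) v u := by simp [F, Matrix.mul_apply]
    rw [h1, h, Matrix.mul_add, Matrix.add_apply, Matrix.add_apply, hF, hF]
    simp [Matrix.one_apply]
  have := exp_mul_eq_mul_exp hK
  rw [exp_kroneckerSum] at this
  ext v u
  have h1 : (exp K * F) v (u, l) = (exp K * f l) v u := by simp [F, Matrix.mul_apply]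
  rw [← h1, this, hF]

end Exponential

/-! ### The transposition attached to the anticommutation form, and `ξ`. -/

section SwapTranspose

variable {ι κ μ : Type*}

/-- The transposition with respect to the bilinear form `(x, y) ↦ ∑ x_k y_{k.swap}` which
expresses the anticommutation relations. -/
def swapTranspose (X : PhaseOp ι κ) : PhaseOp κ ι := Matrix.of fun k l => X l.swap k.swap

lemma swapTranspose_apply (X : PhaseOp ι κ) (k l) : swapTranspose X k l = X l.swap k.swap := rfl

lemma swapTranspose_add (X Y : PhaseOp ι κ) :
    swapTranspose (X + Y) = swapTranspose X + swapTranspose Y := rfl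

lemma swapTranspose_sub (X Y : PhaseOp ι κ) :
    swapTranspose (X - Y) = swapTranspose X - swapTranspose Y := rfl

lemma swapTranspose_neg (X : PhaseOp ι κ) : swapTranspose (-X) = -swapTranspose X := rfl

lemma swapTranspose_smul (c : ℂ) (X : PhaseOp ι κ) :
    swapTranspose (c • X) = c • swapTranspose X := rfl

lemma swapTranspose_swapTranspose (X : PhaseOp ι κ) : swapTranspose (swapTranspose X) = X := by
  ext k l; simp [swapTranspose_apply]

lemma swapTranspose_mul [Fintype κ] (X : PhaseOp ι κ) (Y : PhaseOp κ μ) :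
    swapTranspose (X * Y) = swapTranspose Y * swapTranspose X := by
  ext k l
  simp only [swapTranspose_apply, Matrix.mul_apply]
  rw [← (Equiv.sumComm κ κ).sum_comp]
  exact Finset.sum_congr rfl fun _ _ => mul_comm _ _

lemma trace_swapTranspose [Fintype ι] (X : PhaseOp ι ι) :
    (swapTranspose X).trace = X.trace := by
  simp only [Matrix.trace, Matrix.diag_apply, swapTranspose_apply]
  exact (Equiv.sumComm ι ι).sum_comp fun k => X k k

lemma xiAnti_apply [Fintype κ] {Θ : PhaseOp ι κ} (h : XiAnti Θ) (k l) :
    star (Θ k.swap l.swap) = -Θ k l := by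
  classical
  have := congrFun (h (Pi.single l 1)) k
  have hx : xi (Pi.single l (1 : ℂ)) = Pi.single l.swap (1 : ℂ) := by
    ext j
    simp only [xi, Pi.single_apply]
    have : j.swap = l ↔ j = l.swap := by
      constructor
      · rintro rfl; simp
      · rintro rfl; simp
    by_cases hj : j = l.swap <;> simp [this, hj]
  rw [hx] at this
  simpa [xi, Matrix.mulVec_single] using this

/-- This turns the anti-linear condition into a linear identity; for Hermitian operators it says
antisymmetry. -/
lemma XiAnti.swapTranspose [Fintype κ] {Θ : PhaseOp ι κ} (h : XiAnti Θ) :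
    swapTranspose Θ = -Θᴴ := by
  ext k l
  rw [swapTranspose_apply, Matrix.neg_apply, Matrix.conjTranspose_apply, ← star_neg,
    ← xiAnti_apply h, star_star]

lemma XiAnti.swapTranspose_conjTranspose [Fintype κ] {Θ : PhaseOp ι κ} (h : XiAnti Θ) :
    QuasiFree.swapTranspose Θᴴ = -Θ := by
  rw [← neg_eq_iff_eq_neg, ← swapTranspose_neg, ← h.swapTranspose, swapTranspose_swapTranspose]

end SwapTranspose

/-! ### Commutators of quadratic operators. -/

section Quadratic

variable {ι : Type*} [Fintype ι] [LinearOrder ι]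

lemma quadratic_conjTranspose (X : PhaseOp ι ι) : (quadratic X)ᴴ = quadratic Xᴴ := by
  simp only [quadratic, Matrix.conjTranspose_smul, Matrix.conjTranspose_sum,
    Matrix.conjTranspose_mul, Matrix.conjTranspose_conjTranspose, Matrix.conjTranspose_apply]
  rw [Finset.sum_comm]
  congr 1
  simp

variable [dec : DecidableEq ι]

lemma quadratic_eq (X : PhaseOp ι ι) :
    quadratic X = (1 / 2 : ℂ) • ∑ k, ∑ l, X k l • (field k * field l.swap) := by
  obtain rfl : dec = LinearOrder.toDecidableEq := Subsingleton.elim _ _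
  simp only [quadratic, field_conjTranspose]

/-- A commutator with a product of two fields is a difference of anticommutators, which are scalars.
-/
lemma field_mul_field_commutator (k l j : ι ⊕ ι) :
    field k * field l * field j - field j * (field k * field l) =
      (if l = j.swap then (field k : FockOp ι) else 0) -
        (if k = j.swap then field l else 0) := by
  have e : (field k : FockOp ι) * field l * field j - field j * (field k * field l) =
      field k * (field l * field j + field j * field l)
        - (field k * field j + field j * field k) * field l := by noncomm_ring
  rw [e, field_anticomm, field_anticomm]
  split_ifs <;> simp

/-- The commutator of a quadratic operator and a field operator. -/
lemma quadratic_commutator_field {X : PhaseOp ι ι} (hX : swapTranspose X = -X) (j : ι ⊕ ι) :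
    quadratic X * field j - field j * quadratic X = ∑ k, X k j • field k := by
  have h1 : ∀ l : ι ⊕ ι, (l.swap = j.swap) ↔ l = j :=
    fun l => Sum.swap_leftInverse.injective.eq_iff
  have h2 : quadratic X * field j - field j * quadratic X =
      (1 / 2 : ℂ) • ∑ k, ∑ l, X k l • ((if l = j then (field k : FockOp ι) else 0) -
        (if k = j.swap then field l.swap else 0)) := by
    simp only [quadratic_eq, Matrix.smul_mul, Matrix.mul_smul, Finset.sum_mul, Finset.mul_sum,
      ← smul_sub, ← Finset.sum_sub_distrib, field_mul_field_commutator, h1]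
  -- By antisymmetry of `X` both contractions contribute equally, which cancels the factor ½.
  have h3 : ∑ l, X j.swap l • (field l.swap : FockOp ι) = - ∑ k, X k j • field k := by
    rw [← (Equiv.sumComm ι ι).sum_comp, ← Finset.sum_neg_distrib]
    refine Finset.sum_congr rfl fun k _ => ?_
    rw [← neg_smul]
    congr 1
    · exact congrFun (congrFun hX k) j
    · simp
  have h4 : ∑ k, ∑ l, X k l • ((if l = j then (field k : FockOp ι) else 0) -
        (if k = j.swap then field l.swap else 0)) =
      ∑ k, X k j • field k - ∑ l, X j.swap l • (field l.swap : FockOp ι) := by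
    simp only [smul_sub, Finset.sum_sub_distrib, smul_ite, smul_zero]
    congr 1
    · simp
    · rw [Finset.sum_comm]; simp
  rw [h2, h4, h3, sub_neg_eq_add, ← two_smul ℂ, smul_smul]
  norm_num

lemma quadratic_commutator_field_swap {X : PhaseOp ι ι} (hX : swapTranspose X = -X)
    (j : ι ⊕ ι) :
    quadratic X * field j.swap - field j.swap * quadratic X = -∑ k, X j k • field k.swap := by
  rw [quadratic_commutator_field hX, ← (Equiv.sumComm ι ι).sum_comp, ← Finset.sum_neg_distrib]
  refine Finset.sum_congr rfl fun k _ => ?_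
  rw [← neg_smul]
  congr 1
  have := congrFun (congrFun hX j) k
  rw [swapTranspose_apply, Matrix.neg_apply] at this
  exact this

/-- Quadratic operators form a Lie algebra. -/
lemma quadratic_commutator_quadratic {T : PhaseOp ι ι} (hT : swapTranspose T = -T)
    (X : PhaseOp ι ι) :
    quadratic T * quadratic X - quadratic X * quadratic T = quadratic (T * X - X * T) := by
  have h0 : ∀ k l : ι ⊕ ι, quadratic T * (field k * field l.swap) -
      field k * field l.swap * quadratic T =
      ∑ j, T j k • (field j * field l.swap) - ∑ j, T l j • (field k * field j.swap) := by
    intro k l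
    have e : quadratic T * (field k * field l.swap) - field k * field l.swap * quadratic T =
        (quadratic T * field k - field k * quadratic T) * field l.swap +
        field k * (quadratic T * field l.swap - field l.swap * quadratic T) := by noncomm_ring
    rw [e, quadratic_commutator_field hT, quadratic_commutator_field_swap hT]
    simp only [Finset.sum_mul, Matrix.smul_mul, mul_neg, Finset.mul_sum, Matrix.mul_smul]
    rw [sub_eq_add_neg]
  have h1 : quadratic T * quadratic X - quadratic X * quadratic T =
      (1 / 2 : ℂ) • ∑ k, ∑ l, X k l • (∑ j, T j k • (field j * field l.swap) -
        ∑ j, T l j • (field k * field j.swap)) := by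
    rw [quadratic_eq X]
    simp only [Matrix.smul_mul, Matrix.mul_smul, Finset.sum_mul, Finset.mul_sum,
      ← smul_sub, ← Finset.sum_sub_distrib]
    simp only [Finset.sum_sub_distrib, ← h0]
  rw [h1, quadratic_eq]
  congr 1
  simp only [smul_sub, Finset.sum_sub_distrib, Matrix.sub_apply, sub_smul, Matrix.mul_apply,
    Finset.sum_smul, Finset.smul_sum, smul_smul]
  congr 1
  · calc _ = ∑ k, ∑ j, ∑ l, (X k l * T j k) • (field j * field l.swap : FockOp ι) :=
          Finset.sum_congr rfl fun k _ => Finset.sum_comm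
      _ = ∑ j, ∑ k, ∑ l, (X k l * T j k) • (field j * field l.swap : FockOp ι) :=
          Finset.sum_comm
      _ = _ := Finset.sum_congr rfl fun j _ => by
          rw [Finset.sum_comm]
          exact Finset.sum_congr rfl fun _ _ => Finset.sum_congr rfl fun _ _ => by rw [mul_comm]
  · exact Finset.sum_congr rfl fun k _ => Finset.sum_comm

end Quadratic

/-- The exponential is the square of the invertible Hermitian matrix `exp (A / 2)`. -/
lemma posDef_exp {a : Type*} [Fintype a] [DecidableEq a] {A : Matrix a a ℂ}
    (hA : A.IsHermitian) : (NormedSpace.exp A).PosDef := by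
  have hh : ((1 / 2 : ℂ) • A).IsHermitian := by
    rw [Matrix.IsHermitian, Matrix.conjTranspose_smul, hA.eq]; simp
  have h2 : NormedSpace.exp A =
      NormedSpace.exp ((1 / 2 : ℂ) • A) * (NormedSpace.exp ((1 / 2 : ℂ) • A))ᴴ := by
    rw [hh.exp.eq, ← Matrix.exp_add_of_commute _ _ (Commute.refl _), ← two_smul ℂ, smul_smul]
    norm_num
  rw [h2]
  exact Matrix.PosDef.mul_conjTranspose_self _
    (Matrix.vecMul_injective_iff_isUnit.2 (Matrix.isUnit_exp _))

/-! ### Two-point functions and the Fermi-Dirac law. -/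

section Covariance

variable {ι : Type*} [Fintype ι] [LinearOrder ι] [DecidableEq ι]

/-- The matrix `Tr (ρ φ(e_k)^* φ(e_l))` of two-point functions of `ρ`. -/
def covariance (ρ : FockOp ι) : PhaseOp ι ι :=
  Matrix.of fun k l => (ρ * (field k.swap * field l)).trace

/-- The anticommutation relations trade the order of the fields for `1 - covariance`, by
normalization of `ρ`. -/
lemma trace_mul_field_mul_field {ρ : FockOp ι} (hρ : ρ.trace = 1) (k l : ι ⊕ ι) :
    (ρ * (field k * field l)).trace = (1 - covariance ρ) l.swap k := by
  have h := congrArg (fun A => (ρ * A).trace) (field_anticomm k l)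
  simp only [mul_add, Matrix.trace_add] at h
  rw [Matrix.sub_apply, Matrix.one_apply, covariance, Matrix.of_apply, Sum.swap_swap]
  rw [← eq_sub_iff_add_eq] at h
  rw [h]
  congr 1
  simp only [eq_comm (a := l.swap)]
  split_ifs <;> simp [hρ]

lemma covariance_isHermitian {ρ : FockOp ι} (hρ : ρ.IsHermitian) :
    (covariance ρ).IsHermitian := by
  ext k l
  rw [Matrix.conjTranspose_apply]
  simp only [covariance, Matrix.of_apply]
  rw [← Matrix.trace_conjTranspose, Matrix.conjTranspose_mul, Matrix.conjTranspose_mul,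
    field_conjTranspose, field_conjTranspose, Sum.swap_swap, hρ.eq, Matrix.trace_mul_comm]

lemma swapTranspose_covariance {ρ : FockOp ι} (hρ : ρ.trace = 1) :
    swapTranspose (covariance ρ) = 1 - covariance ρ := by
  ext k l
  rw [swapTranspose_apply, covariance, Matrix.of_apply, Sum.swap_swap,
    trace_mul_field_mul_field hρ, Sum.swap_swap]
  rfl

lemma trace_mul_sum_field (ρ : FockOp ι) (Y : PhaseOp ι ι) :
    (ρ * ∑ j, ∑ k, Y j k • (field k.swap * field j)).trace = (Y * covariance ρ).trace := by
  simp only [Finset.mul_sum, Matrix.mul_smul, Matrix.trace_sum, Matrix.trace_smul]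
  simp [Matrix.trace, Matrix.mul_apply, covariance]

lemma trace_mul_quadratic {ρ : FockOp ι} (hρ : ρ.trace = 1) (X : PhaseOp ι ι) :
    (ρ * quadratic X).trace = (1 / 2 : ℂ) * (X * (1 - covariance ρ)).trace := by
  rw [quadratic_eq, Matrix.mul_smul, Matrix.trace_smul, smul_eq_mul]
  simp only [Finset.mul_sum, Matrix.mul_smul, Matrix.trace_sum, Matrix.trace_smul,
    trace_mul_field_mul_field hρ, Sum.swap_swap]
  simp only [Matrix.trace, Matrix.mul_apply, Matrix.diag_apply, smul_eq_mul, Finset.mul_sum]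

/-- The covariance of the Gibbs state of a quadratic Hamiltonian is a Fermi-Dirac distribution. -/
lemma gibbs_quadratic {κ : PhaseOp ι ι} (hκ : κ.IsHermitian) (hκs : swapTranspose κ = -κ) :
    (gibbs (quadratic κ)).trace = 1 ∧ (gibbs (quadratic κ)).IsHermitian ∧
      covariance (gibbs (quadratic κ)) * (1 + NormedSpace.exp (-κ)) = 1 := by
  set K := quadratic κ with hK
  have hKh : (-K).IsHermitian := by
    have : K.IsHermitian := by rw [hK, Matrix.IsHermitian, quadratic_conjTranspose, hκ.eq]
    exact this.neg
  have hpos : (NormedSpace.exp (-K)).PosDef := posDef_exp hKh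
  have htr : (NormedSpace.exp (-K)).trace ≠ 0 := hpos.trace_pos.ne'
  have h1 : (gibbs K).trace = 1 := by
    rw [gibbs, Matrix.trace_smul, smul_eq_mul, inv_mul_cancel₀ htr]
  have hherm : (gibbs K).IsHermitian := by
    have h0 := hpos.isHermitian.eq
    have ht : star (NormedSpace.exp (-K)).trace = (NormedSpace.exp (-K)).trace := by
      rw [← Matrix.trace_conjTranspose, h0]
    rw [gibbs, Matrix.IsHermitian, Matrix.conjTranspose_smul, h0, star_inv₀, ht]
  refine ⟨h1, hherm, ?_⟩
  have hcomm : ∀ l : ι ⊕ ι, -K * field l = field l * -K + ∑ k, (-κ) k l • field k := by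
    intro l
    have := quadratic_commutator_field hκs l
    simp only [Matrix.neg_apply, neg_smul, Finset.sum_neg_distrib, ← this, ← hK]
    noncomm_ring
  -- The KMS relation. Moving a field around the trace costs a factor `exp (-κ)`; comparison with
  -- the anticommutator determines the covariance.
  have hkms : ∀ l : ι ⊕ ι, gibbs K * field l =
      ∑ k, NormedSpace.exp (-κ) k l • (field k * gibbs K) := by
    intro l
    rw [gibbs, Matrix.smul_mul, exp_mul_of_commutator hcomm, Finset.smul_sum]
    refine Finset.sum_congr rfl fun k _ => ?_
    rw [Matrix.mul_smul, smul_comm]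
  rw [mul_add, mul_one, ← eq_sub_iff_add_eq']
  ext k l
  have h2 := trace_mul_field_mul_field h1 l k.swap
  rw [Sum.swap_swap, ← mul_assoc, hkms] at h2
  rw [← h2, Matrix.mul_apply, Finset.sum_mul, Matrix.trace_sum]
  refine Finset.sum_congr rfl fun j _ => ?_
  rw [Matrix.smul_mul, Matrix.trace_smul, covariance, Matrix.of_apply, smul_eq_mul, mul_comm,
    mul_assoc, Matrix.trace_mul_comm (field j), mul_assoc]

end Covariance

/-! ### Dissipators with linear jump operators. -/

section Lindblad

variable {ι : Type*} [Fintype ι] [LinearOrder ι] [DecidableEq ι]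

/-- The completely positive map with the field operators as jump operators and the rates `M`. -/
def jumpMap (M : PhaseOp ι ι) (A : FockOp ι) : FockOp ι :=
  ∑ j, ∑ k, M j k • (field k.swap * A * field j)

/-- Each term has the form L'QL - ½{L'L, Q} = ½(L'[Q, L] - [Q, L']L). Commutators of `Q` with fields
are linear in fields, so the result stays quadratic. -/
lemma jumpMap_dissipator_quadratic (M : PhaseOp ι ι) {X : PhaseOp ι ι}
    (hX : swapTranspose X = -X) :
    jumpMap M (quadratic X) -
      (1 / 2 : ℂ) • (jumpMap M 1 * quadratic X + quadratic X * jumpMap M 1) =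
      ∑ j, ∑ k, ((1 / 2 : ℂ) • (X * M + M * X)) j k • (field k.swap * field j) := by
  set Q := quadratic X with hQ
  have hterm : ∀ j k : ι ⊕ ι, (field k.swap * Q * field j : FockOp ι) -
      (1 / 2 : ℂ) • (field k.swap * 1 * field j * Q + Q * (field k.swap * 1 * field j)) =
      (1 / 2 : ℂ) • (∑ i, X i j • (field k.swap * field i) +
        ∑ i, X k i • (field i.swap * field j)) := by
    intro j k
    have e1 : ∑ i, X i j • (field k.swap * field i : FockOp ι) =
        field k.swap * (Q * field j - field j * Q) := by
      rw [hQ, quadratic_commutator_field hX, Finset.mul_sum]; simp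
    have e2 : ∑ i, X k i • (field i.swap * field j : FockOp ι) =
        -((Q * field k.swap - field k.swap * Q) * field j) := by
      rw [hQ, quadratic_commutator_field_swap hX, neg_mul, neg_neg, Finset.sum_mul]; simp
    rw [e1, e2, ← sub_eq_zero]
    have e3 : (field k.swap * Q * field j : FockOp ι) =
      (1 / 2 : ℂ) • ((2 : ℂ) • (field k.swap * Q * field j)) := by
      rw [smul_smul]; norm_num
    rw [e3, ← smul_sub, ← smul_sub, two_smul]
    rw [show (field k.swap * Q * field j + field k.swap * Q * field j -
      (field k.swap * 1 * field j * Q + Q * (field k.swap * 1 * field j)) -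
      (field k.swap * (Q * field j - field j * Q) +
      -((Q * field k.swap - field k.swap * Q) * field j)) : FockOp ι) = 0 by noncomm_ring, smul_zero]
  have h1 : jumpMap M Q - (1 / 2 : ℂ) • (jumpMap M 1 * Q + Q * jumpMap M 1) =
      ∑ j, ∑ k, M j k • ((1 / 2 : ℂ) • (∑ i, X i j • (field k.swap * field i : FockOp ι) +
        ∑ i, X k i • (field i.swap * field j))) := by
    simp only [← hterm, smul_sub, Finset.sum_sub_distrib, jumpMap]
    congr 1
    simp only [Finset.sum_mul, Finset.mul_sum, Matrix.smul_mul, Matrix.mul_smul,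
      ← Finset.sum_add_distrib, Finset.smul_sum, ← smul_add]
    exact Finset.sum_congr rfl fun _ _ => Finset.sum_congr rfl fun _ _ => smul_comm _ _ _
  rw [h1]
  simp only [Matrix.smul_apply, Matrix.add_apply, smul_eq_mul, mul_smul, add_smul,
    smul_add, Finset.sum_add_distrib]
  have smul3 : ∀ (a b c : ℂ) (A : FockOp ι), a • b • c • A = b • (a * c) • A := fun a b c A => by
    rw [smul_comm a b, smul_smul a c]
  congr 1
  · simp only [Matrix.mul_apply, Finset.sum_smul, Finset.smul_sum, smul3]
    calc _ = ∑ j, ∑ i, ∑ k, (1 / 2 : ℂ) • (M j k * X i j) • (field k.swap * field i : FockOp ι) :=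
          Finset.sum_congr rfl fun _ _ => Finset.sum_comm
      _ = ∑ i, ∑ j, ∑ k, (1 / 2 : ℂ) • (M j k * X i j) • (field k.swap * field i : FockOp ι) :=
          Finset.sum_comm
      _ = _ := Finset.sum_congr rfl fun i _ => by
          rw [Finset.sum_comm]
          exact Finset.sum_congr rfl fun _ _ => Finset.sum_congr rfl fun _ _ => by rw [mul_comm]
  · simp only [Matrix.mul_apply, Finset.sum_smul, Finset.smul_sum, smul3]
    exact Finset.sum_congr rfl fun _ _ => Finset.sum_comm

end Lindblad

/-! ### Elimination of the baths. -/

section PartialTrace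

variable {a b : Type*} [Fintype b]

lemma partialTrace_kronecker (X : Matrix a a ℂ) (Y : Matrix b b ℂ) :
    partialTrace (X ⊗ₖ Y) = Y.trace • X := by
  ext u v
  simp [partialTrace, Matrix.trace, Finset.mul_sum, mul_comm]

lemma partialTrace_sum {α : Type*} (s : Finset α) (f : α → Matrix (a × b) (a × b) ℂ) :
    partialTrace (∑ i ∈ s, f i) = ∑ i ∈ s, partialTrace (f i) := by
  ext u v
  simp only [partialTrace, Matrix.of_apply, Matrix.sum_apply]
  exact Finset.sum_comm

end PartialTrace

namespace ThermalModel

variable {n : ℕ} (m : ThermalModel n)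

/-- The interaction of the system with the total bath, with coupling matrix `Θ`. -/
def interaction (Θ : PhaseOp (Fin m.LS) m.BathMode) : m.TotOp :=
  ∑ k, ∑ l, Θ k l • (m.fieldS k * (m.fieldB l)ᴴ)

/-- The interaction is linear in the bath fields, so the partial trace involves only the two-point
functions of the bath. -/
lemma Φ_interaction {Θ : PhaseOp (Fin m.LS) m.BathMode} (hΘ : swapTranspose Θ = -Θᴴ) (hρ : m.ρB.trace = 1)
    (A : m.SysOp) :
    m.Φ (m.interaction Θ) A = jumpMap (Θ * (1 - covariance m.ρB) * Θᴴ) A := by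
  let B : Fin m.LS ⊕ Fin m.LS → FockOp m.BathMode :=
    fun k => ∑ l, Θ k l • (parity m.BathMode * field l.swap)
  have hV : m.interaction Θ = ∑ k, field k ⊗ₖ B k := by
    refine Finset.sum_congr rfl fun k _ => ?_
    simp only [B, fieldS, fieldB]
    simp only [Matrix.conjTranspose_kronecker, Matrix.conjTranspose_one, field_conjTranspose,
      ← Matrix.mul_kronecker_mul, mul_one]
    ext ⟨u, w⟩ ⟨u', w'⟩
    simp only [Matrix.sum_apply, Matrix.smul_apply, Matrix.kronecker_apply, smul_eq_mul,
      Finset.mul_sum]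
    exact Finset.sum_congr rfl fun _ _ => by ring
  have htr : ∀ k k', (B k * (B k' * m.ρB)).trace =
      (Θ * (1 - covariance m.ρB) * Θᴴ : PhaseOp (Fin m.LS) (Fin m.LS)) k' k.swap := by
    intro k k'
    -- Moving one parity past a field gives a minus sign; the antisymmetry of `Θ` in `h2`
    -- compensates it.
    have h1 : ∀ l l' : m.BathMode ⊕ m.BathMode, ((parity m.BathMode * field l.swap) *
        (parity m.BathMode * field l'.swap * m.ρB)).trace =
          -(1 - covariance m.ρB : PhaseOp m.BathMode m.BathMode) l' l.swap := by
      intro l l'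
      have e : (parity m.BathMode * field l.swap) *
        (parity m.BathMode * field l'.swap * m.ρB) =
        -((parity m.BathMode * parity m.BathMode) * (field l.swap * field l'.swap * m.ρB)) := by
        have := parity_mul_field (ι := m.BathMode) l.swap
        rw [← neg_eq_iff_eq_neg] at this
        calc _ = parity m.BathMode * (field l.swap * parity m.BathMode) *
              (field l'.swap * m.ρB) := by noncomm_ring
          _ = _ := by rw [← this]; noncomm_ring
      rw [e, parity_mul_parity, one_mul, Matrix.trace_neg, Matrix.trace_mul_comm,
        trace_mul_field_mul_field hρ, Sum.swap_swap]
    have h2 : ∀ l, Θᴴ l.swap k.swap = -Θ k l := fun l => by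
      have := congrFun (congrFun hΘ l.swap) k.swap
      rw [swapTranspose_apply, Sum.swap_swap, Sum.swap_swap, Matrix.neg_apply] at this
      rw [this, neg_neg]
    simp only [B, Finset.sum_mul, Finset.mul_sum, Matrix.smul_mul, Matrix.mul_smul,
      Matrix.trace_sum, Matrix.trace_smul, h1]
    rw [Matrix.mul_apply, Finset.sum_comm]
    refine Fintype.sum_equiv (Equiv.sumComm _ _) _ _ fun l => ?_
    simp only [Equiv.sumComm_apply, h2, Matrix.mul_apply, Finset.sum_mul, smul_eq_mul]
    exact Finset.sum_congr rfl fun _ _ => by ring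
  have hmul : m.interaction Θ * (A ⊗ₖ (1 : FockOp m.BathMode)) * m.interaction Θ *
      ((1 : m.SysOp) ⊗ₖ m.ρB) =
      ∑ k, ∑ k', (field k * A * field k') ⊗ₖ (B k * (B k' * m.ρB)) := by
    rw [hV]
    simp only [Finset.sum_mul, Finset.mul_sum, ← Matrix.mul_kronecker_mul, mul_one, mul_assoc]
    exact Finset.sum_comm
  rw [Φ, hmul, partialTrace_sum]
  simp only [partialTrace_sum, partialTrace_kronecker, htr]
  rw [Finset.sum_comm, jumpMap]
  refine Finset.sum_congr rfl fun j _ => ?_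
  rw [← (Equiv.sumComm _ _).sum_comp]
  simp

end ThermalModel

/-! ### The total bath on the one-particle level: source and damping matrices. -/

namespace ThermalModel

variable {n : ℕ} (m : ThermalModel n)

/-- The projection of the phase space of the total bath onto that of the bath `i`. -/
def bathProj (i : Fin n) : PhaseOp (Fin (m.LB i)) m.BathMode :=
  Matrix.of fun l l' => if m.bathIndex i l = l' then 1 else 0

/-- The coupling of the system to the bath `i`, on the phase space of the total bath. -/
def coupling (i : Fin n) : PhaseOp (Fin m.LS) m.BathMode := m.Θ i * m.bathProj i

/-- The one-particle form of `∑ i, β_i K_{B_i}`. -/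
def κtot : PhaseOp m.BathMode m.BathMode :=
  ∑ i, (m.β i : ℂ) • ((m.bathProj i)ᴴ * m.κB i * m.bathProj i)

/-- The matrix `Θ_i Θ_i^*`. -/
def Γ (i : Fin n) : PhaseOp (Fin m.LS) (Fin m.LS) := m.Θ i * (m.Θ i)ᴴ

/-- The part of `Θ_i Θ_i^*` weighted by the covariance of the state of the bath `i`. -/
def injection (i : Fin n) : PhaseOp (Fin m.LS) (Fin m.LS) :=
  m.coupling i * covariance m.ρB * (m.coupling i)ᴴ

lemma bathIndex_injective (i : Fin n) : Function.Injective (m.bathIndex i) := by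
  have : Function.Injective fun a : Fin (m.LB i) => (toLex ⟨i, a⟩ : m.BathMode) := by
    intro a b h
    simpa using h
  exact Sum.map_injective.2 ⟨this, this⟩

lemma bathIndex_ne {i j : Fin n} (hij : i ≠ j) (k l) : m.bathIndex i k ≠ m.bathIndex j l := by
  rcases k with k | k <;> rcases l with l | l <;> simp [bathIndex, hij]

lemma bathIndex_swap (i : Fin n) (k) : m.bathIndex i k.swap = (m.bathIndex i k).swap := by
  rcases k with k | k <;> rfl

lemma bathProj_mul_conjTranspose_self (i : Fin n) :
    m.bathProj i * (m.bathProj i)ᴴ = 1 := by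
  ext k l
  simp [bathProj, Matrix.mul_apply, Matrix.one_apply, (m.bathIndex_injective i).eq_iff,
    apply_ite (star : ℂ → ℂ), eq_comm]

lemma bathProj_mul_conjTranspose_of_ne {i j : Fin n} (hij : i ≠ j) :
    m.bathProj i * (m.bathProj j)ᴴ = 0 := by
  ext k l
  simp [bathProj, Matrix.mul_apply, m.bathIndex_ne hij, apply_ite (star : ℂ → ℂ)]

lemma swapTranspose_bathProj (i : Fin n) : swapTranspose (m.bathProj i) = (m.bathProj i)ᴴ := by
  ext k l
  have : m.bathIndex i l.swap = k.swap ↔ m.bathIndex i l = k := by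
    rw [bathIndex_swap, Sum.swap_leftInverse.injective.eq_iff]
  simp [swapTranspose_apply, bathProj, this, apply_ite (star : ℂ → ℂ)]

lemma swapTranspose_bathProj_conjTranspose (i : Fin n) :
    swapTranspose (m.bathProj i)ᴴ = m.bathProj i := by
  rw [← swapTranspose_bathProj, swapTranspose_swapTranspose]

lemma swapTranspose_of_isHermitian {ι : Type*} [Fintype ι] {T : PhaseOp ι ι}
    (hT : T.IsHermitian) (hx : XiAnti T) : swapTranspose T = -T := by
  rw [hx.swapTranspose, hT.eq]

lemma swapTranspose_sum {ι κ α : Type*} (s : Finset α) (f : α → PhaseOp ι κ) :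
    swapTranspose (∑ i ∈ s, f i) = ∑ i ∈ s, swapTranspose (f i) := by
  ext k l
  simp [swapTranspose_apply, Matrix.sum_apply]

lemma swapTranspose_κtot : swapTranspose m.κtot = -m.κtot := by
  rw [κtot, swapTranspose_sum, ← Finset.sum_neg_distrib]
  refine Finset.sum_congr rfl fun i _ => ?_
  rw [swapTranspose_smul, swapTranspose_mul, swapTranspose_mul,
    swapTranspose_bathProj_conjTranspose, swapTranspose_bathProj,
    swapTranspose_of_isHermitian (m.κB_herm i) (m.κB_xi i)]
  simp [Matrix.mul_assoc]

lemma κtot_isHermitian : m.κtot.IsHermitian := by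
  rw [Matrix.IsHermitian, κtot, Matrix.conjTranspose_sum]
  refine Finset.sum_congr rfl fun i _ => ?_
  rw [Matrix.conjTranspose_smul, Matrix.conjTranspose_mul, Matrix.conjTranspose_mul,
    Matrix.conjTranspose_conjTranspose, (m.κB_herm i).eq, Matrix.mul_assoc]
  simp

lemma KB_eq (i : Fin n) : m.KB i = quadratic ((m.bathProj i)ᴴ * m.κB i * m.bathProj i) := by
  rw [KB, quadratic_eq]
  congr 1
  have h : ∀ k l, ((m.bathProj i)ᴴ * m.κB i * m.bathProj i) k l =
      ∑ a, ∑ b, if m.bathIndex i a = k then (if m.bathIndex i b = l then m.κB i a b else 0)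
        else 0 := by
    intro k l
    rw [Matrix.mul_assoc, Matrix.mul_apply]
    refine Finset.sum_congr rfl fun a _ => ?_
    rw [Matrix.mul_apply, Finset.mul_sum]
    refine Finset.sum_congr rfl fun b _ => ?_
    by_cases ha : m.bathIndex i a = k <;> simp [bathProj, ha]
  simp only [h, Finset.sum_smul, field_conjTranspose]
  symm
  calc _ = ∑ k, ∑ a, ∑ l, ∑ b, (if m.bathIndex i a = k then
          (if m.bathIndex i b = l then m.κB i a b else 0) else 0) •
            (field k * field l.swap : FockOp m.BathMode) :=
        Finset.sum_congr rfl fun _ _ => Finset.sum_comm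
    _ = ∑ a, ∑ k, ∑ b, ∑ l, (if m.bathIndex i a = k then
          (if m.bathIndex i b = l then m.κB i a b else 0) else 0) •
            (field k * field l.swap : FockOp m.BathMode) := by
        rw [Finset.sum_comm]
        exact Finset.sum_congr rfl fun _ _ => Finset.sum_congr rfl fun _ _ => Finset.sum_comm
    _ = ∑ a, ∑ b, ∑ k, ∑ l, (if m.bathIndex i a = k then
          (if m.bathIndex i b = l then m.κB i a b else 0) else 0) •
            (field k * field l.swap : FockOp m.BathMode) :=
        Finset.sum_congr rfl fun _ _ => Finset.sum_comm
    _ = _ := by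
        refine Finset.sum_congr rfl fun a _ => Finset.sum_congr rfl fun b _ => ?_
        rw [Finset.sum_eq_single (m.bathIndex i a), Finset.sum_eq_single (m.bathIndex i b)]
        · simp
        · intro l _ hl; simp [hl.symm]
        · simp
        · intro k _ hk; simp [hk.symm]
        · simp

lemma quadratic_sum_smul {ι α : Type*} [Fintype ι] [LinearOrder ι] (s : Finset α) (c : α → ℂ)
    (X : α → PhaseOp ι ι) :
    quadratic (∑ i ∈ s, c i • X i) = ∑ i ∈ s, c i • quadratic (X i) := by
  simp only [quadratic, smul_comm (c _) (1 / 2 : ℂ), ← Finset.smul_sum]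
  congr 1
  simp only [Matrix.sum_apply, Matrix.smul_apply, Finset.sum_smul, smul_assoc, Finset.smul_sum]
  rw [Finset.sum_comm' (s := s) (t' := Finset.univ) (s' := fun _ => s) (by simp)]
  exact Finset.sum_congr rfl fun _ _ => Finset.sum_comm

/-- Absorbing the temperatures into `κtot` makes the product of bath states a single quasi-free
Gibbs state. -/
lemma ρB_eq : m.ρB = gibbs (quadratic m.κtot) := by
  rw [ρB, κtot, quadratic_sum_smul]
  simp only [KB_eq]

lemma ρB_covariance : m.ρB.trace = 1 ∧ m.ρB.IsHermitian ∧
    covariance m.ρB * (1 + NormedSpace.exp (-m.κtot)) = 1 := by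
  rw [ρB_eq]
  exact gibbs_quadratic m.κtot_isHermitian m.swapTranspose_κtot

lemma coupling_mul_conjTranspose_self (i : Fin n) :
    m.coupling i * (m.coupling i)ᴴ = m.Γ i := by
  rw [coupling, Matrix.conjTranspose_mul, Matrix.mul_assoc, ← Matrix.mul_assoc (m.bathProj i),
    bathProj_mul_conjTranspose_self, Matrix.one_mul, Γ]

lemma coupling_mul_conjTranspose_of_ne {i j : Fin n} (hij : i ≠ j) :
    m.coupling i * (m.coupling j)ᴴ = 0 := by
  rw [coupling, coupling, Matrix.conjTranspose_mul, Matrix.mul_assoc,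
    ← Matrix.mul_assoc (m.bathProj i), bathProj_mul_conjTranspose_of_ne m hij, Matrix.zero_mul,
    Matrix.mul_zero]

lemma swapTranspose_coupling (i : Fin n) : swapTranspose (m.coupling i) = -(m.coupling i)ᴴ := by
  rw [coupling, swapTranspose_mul, (m.Θ_xi i).swapTranspose, swapTranspose_bathProj,
    Matrix.conjTranspose_mul, Matrix.mul_neg]

lemma swapTranspose_coupling_conjTranspose (i : Fin n) :
    swapTranspose (m.coupling i)ᴴ = -m.coupling i := by
  rw [← neg_eq_iff_eq_neg, ← swapTranspose_neg, ← swapTranspose_coupling,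
    swapTranspose_swapTranspose]

/-- Orthogonality of the baths leaves only the term `i`, where Θ_i κ_i = κ_S Θ_i transfers the
pseudo-energy to the system. -/
lemma coupling_mul_κtot (i : Fin n) :
    m.coupling i * m.κtot = ((m.β i : ℂ) • m.κS) * m.coupling i := by
  rw [κtot, Matrix.mul_sum, Finset.sum_eq_single i]
  · rw [coupling, Matrix.mul_smul, Matrix.smul_mul]
    congr 1
    calc _ = m.Θ i * (m.bathProj i * (m.bathProj i)ᴴ) * m.κB i * m.bathProj i := by
          simp only [Matrix.mul_assoc]
      _ = _ := by
          rw [bathProj_mul_conjTranspose_self, Matrix.mul_one, m.conserved_SB i, Matrix.mul_assoc]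
  · intro j _ hj
    rw [coupling, Matrix.mul_smul]
    have : m.Θ i * m.bathProj i * ((m.bathProj j)ᴴ * m.κB j * m.bathProj j) =
        m.Θ i * (m.bathProj i * (m.bathProj j)ᴴ) * m.κB j * m.bathProj j := by
      simp only [Matrix.mul_assoc]
    rw [this, bathProj_mul_conjTranspose_of_ne m hj.symm]
    simp
  · simp

/-- The one-particle Boltzmann factor of the system at the temperature of the bath `i`. -/
def boltzmann (i : Fin n) : PhaseOp (Fin m.LS) (Fin m.LS) :=
  NormedSpace.exp (-((m.β i : ℂ) • m.κS))

lemma β_smul_κS_isHermitian (i : Fin n) : ((m.β i : ℂ) • m.κS).IsHermitian := by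
  rw [Matrix.IsHermitian, Matrix.conjTranspose_smul, m.κS_herm.eq]
  simp

lemma isUnit_one_add_boltzmann (i : Fin n) : IsUnit (1 + m.boltzmann i) :=
  (Matrix.PosDef.one.add (posDef_exp (m.β_smul_κS_isHermitian i).neg)).isUnit

lemma exp_κtot_mul_coupling_conjTranspose (i : Fin n) :
    NormedSpace.exp (-m.κtot) * (m.coupling i)ᴴ = (m.coupling i)ᴴ * m.boltzmann i := by
  refine exp_mul_eq_mul_exp ?_
  have := congrArg Matrix.conjTranspose (m.coupling_mul_κtot i)
  rw [Matrix.conjTranspose_mul, Matrix.conjTranspose_mul, (m.β_smul_κS_isHermitian i).eq,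
    m.κtot_isHermitian.eq] at this
  rw [Matrix.neg_mul, this, Matrix.mul_neg]

/-- The Boltzmann factor of the system is pulled through the coupling to that of the bath, where the
Fermi-Dirac law applies. -/
lemma coupling_covariance_mul (i j : Fin n) :
    m.coupling i * covariance m.ρB * (m.coupling j)ᴴ * (1 + m.boltzmann j) =
      m.coupling i * (m.coupling j)ᴴ := by
  calc _ = m.coupling i * (covariance m.ρB * (1 + NormedSpace.exp (-m.κtot))) *
        (m.coupling j)ᴴ := by
        simp only [Matrix.mul_add, Matrix.add_mul, Matrix.mul_assoc, Matrix.mul_one,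
          exp_κtot_mul_coupling_conjTranspose]
    _ = _ := by rw [m.ρB_covariance.2.2, Matrix.mul_one]

lemma injection_mul (i : Fin n) : m.injection i * (1 + m.boltzmann i) = m.Γ i := by
  rw [injection, coupling_covariance_mul, coupling_mul_conjTranspose_self]

/-- Distinct baths are uncorrelated: the invertible Boltzmann factor can be cancelled. Hence the
rates of different baths add without cross terms. -/
lemma coupling_covariance_of_ne {i j : Fin n} (hij : i ≠ j) :
    m.coupling i * covariance m.ρB * (m.coupling j)ᴴ = 0 := by
  have h := m.coupling_covariance_mul i j
  rw [coupling_mul_conjTranspose_of_ne m hij] at h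
  exact (m.isUnit_one_add_boltzmann j).mul_left_eq_zero.1 h

lemma swapTranspose_Γ (i : Fin n) : swapTranspose (m.Γ i) = m.Γ i := by
  rw [Γ, swapTranspose_mul, (m.Θ_xi i).swapTranspose, (m.Θ_xi i).swapTranspose_conjTranspose,
    Matrix.neg_mul, Matrix.mul_neg, neg_neg]

/-- Transposition exchanges the bath covariance C with 1 - C, that is, gain rates with loss rates.
-/
lemma swapTranspose_injection (i : Fin n) :
    swapTranspose (m.injection i) = m.Γ i - m.injection i := by
  rw [injection, swapTranspose_mul, swapTranspose_mul, swapTranspose_coupling,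
    swapTranspose_coupling_conjTranspose, swapTranspose_covariance m.ρB_covariance.1,
    ← coupling_mul_conjTranspose_self]
  simp only [Matrix.mul_sub, Matrix.sub_mul, Matrix.mul_assoc, Matrix.neg_mul, Matrix.mul_neg,
    Matrix.one_mul]
  abel

lemma injection_isHermitian (i : Fin n) : (m.injection i).IsHermitian :=
  Matrix.isHermitian_mul_mul_conjTranspose _ (covariance_isHermitian m.ρB_covariance.2.1)

lemma Γ_posSemidef (i : Fin n) : (m.Γ i).PosSemidef :=
  Matrix.posSemidef_self_mul_conjTranspose _

lemma commute_Γ_κS (i : Fin n) : Commute (m.Γ i) m.κS := by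
  have h := congrArg Matrix.conjTranspose (m.conserved_SB i)
  rw [Matrix.conjTranspose_mul, Matrix.conjTranspose_mul, m.κS_herm.eq, (m.κB_herm i).eq] at h
  rw [commute_iff_eq, Γ, Matrix.mul_assoc, ← h, ← Matrix.mul_assoc, m.conserved_SB i,
    Matrix.mul_assoc]

lemma HSB_eq (i : Fin n) : m.HSB i = m.interaction (m.coupling i) := by
  rw [HSB, interaction]
  refine Finset.sum_congr rfl fun k _ => ?_
  simp only [coupling, Matrix.mul_apply, Finset.sum_smul]
  rw [Finset.sum_comm]
  refine Finset.sum_congr rfl fun l _ => ?_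
  rw [Finset.sum_eq_single (m.bathIndex i l)]
  · simp [bathProj]
  · intro l' _ hl; simp [bathProj, hl.symm]
  · simp

lemma sum_HSB_eq : ∑ i, m.HSB i = m.interaction (∑ i, m.coupling i) := by
  simp only [HSB_eq, interaction, Matrix.sum_apply, Finset.sum_smul]
  rw [Finset.sum_comm]
  exact Finset.sum_congr rfl fun _ _ => Finset.sum_comm

lemma dissipator_interaction {Θ : PhaseOp (Fin m.LS) m.BathMode} (hΘ : swapTranspose Θ = -Θᴴ)
    {X : PhaseOp (Fin m.LS) (Fin m.LS)} (hX : swapTranspose X = -X) (ρ : m.SysOp) :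
    (ρ * m.dissipator (m.interaction Θ) (quadratic X)).trace =
      (1 / 2 : ℂ) * ((X * (Θ * (1 - covariance m.ρB) * Θᴴ) +
        Θ * (1 - covariance m.ρB) * Θᴴ * X) * covariance ρ).trace := by
  rw [dissipator, m.Φ_interaction hΘ m.ρB_covariance.1, m.Φ_interaction hΘ m.ρB_covariance.1,
    jumpMap_dissipator_quadratic _ hX, trace_mul_sum_field, Matrix.smul_mul, Matrix.trace_smul,
    smul_eq_mul]

lemma coupling_rates (i : Fin n) :
    m.coupling i * (1 - covariance m.ρB) * (m.coupling i)ᴴ = m.Γ i - m.injection i := by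
  rw [Matrix.mul_sub, Matrix.sub_mul, Matrix.mul_one, coupling_mul_conjTranspose_self, injection]

lemma sum_coupling_rates :
    (∑ i, m.coupling i) * (1 - covariance m.ρB) * (∑ i, m.coupling i)ᴴ =
      ∑ i, m.Γ i - ∑ i, m.injection i := by
  rw [Matrix.conjTranspose_sum, Matrix.sum_mul, Matrix.sum_mul, ← Finset.sum_sub_distrib]
  refine Finset.sum_congr rfl fun i _ => ?_
  rw [Matrix.mul_sum, Finset.sum_eq_single i]
  · exact m.coupling_rates i
  · intro j _ hj
    rw [Matrix.mul_sub, Matrix.sub_mul, Matrix.mul_one,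
      coupling_mul_conjTranspose_of_ne m hj.symm, coupling_covariance_of_ne m hj.symm, sub_zero]
  · simp

end ThermalModel

/-! ### Lyapunov inequality and functional calculus. -/

section Lyapunov

variable {a : Type*} [Fintype a] [DecidableEq a]

open scoped MatrixOrder in
lemma trace_mul_re_nonneg {A B : Matrix a a ℂ} (hA : A.PosSemidef) (hB : B.PosSemidef) :
    0 ≤ (A * B).trace.re := by
  obtain ⟨C, rfl⟩ := CStarAlgebra.nonneg_iff_eq_star_mul_self.1 hA.nonneg
  rw [Matrix.star_eq_conjTranspose, Matrix.mul_assoc, Matrix.trace_mul_comm]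
  exact (Complex.nonneg_iff.1 (hB.mul_mul_conjTranspose_same C).trace_nonneg).1

/-- The spectrum is finite, so even the indicator of the negative axis is admissible in the
functional calculus. -/
lemma continuousOn_spectrum (A : Matrix a a ℂ) (f : ℝ → ℝ) : ContinuousOn f (spectrum ℝ A) :=
  A.finite_real_spectrum.continuousOn f

open scoped MatrixOrder in
/-- The spectral projection of a Hermitian matrix on its negative part. -/
lemma exists_negative_projection {W : Matrix a a ℂ} (hW : W.IsHermitian) :
    ∃ Q : Matrix a a ℂ, (1 - Q).PosSemidef ∧ Q.PosSemidef ∧ Q * W = W * Q ∧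
      (-(Q * W)).PosSemidef ∧ (W - Q * W).PosSemidef := by
  have hW' : IsSelfAdjoint W := hW
  let f : ℝ → ℝ := fun x => if x < 0 then 1 else 0
  have hc := continuousOn_spectrum W
  have h1 : cfc f W * W = cfc (fun x => f x * x) W := by
    rw [cfc_mul f (fun x => x) W (hc _) (hc _), cfc_id' ℝ W (ha := hW')]
  refine ⟨cfc f W, ?_, ?_, ?_, ?_, ?_⟩
  · rw [← cfc_one ℝ W (ha := hW'), ← cfc_sub _ _ W (hc _) (hc _), ← Matrix.nonneg_iff_posSemidef]
    refine cfc_nonneg fun x _ => ?_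
    simp only [f, Pi.one_apply]
    split_ifs <;> norm_num
  · rw [← Matrix.nonneg_iff_posSemidef]
    refine cfc_nonneg fun x _ => ?_
    simp only [f]
    split_ifs <;> norm_num
  · exact ((Commute.refl W).cfc (by rw [hW'.star_eq]; exact Commute.refl W) f).eq
  · rw [h1, ← cfc_neg, ← Matrix.nonneg_iff_posSemidef]
    refine cfc_nonneg fun x _ => ?_
    simp only [f]
    split_ifs <;> linarith
  · rw [h1]
    conv => enter [1, 1]; rw [← cfc_id' ℝ W (ha := hW')]
    rw [← cfc_sub _ _ W (hc _) (hc _), ← Matrix.nonneg_iff_posSemidef]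
    refine cfc_nonneg fun x _ => ?_
    simp only [f]
    split_ifs <;> linarith

/-- If `W` solves a Lyapunov equation whose sources are negative in `A` and positive outside `A`,
then the net production in `A` is negative. -/
lemma lyapunov_sum_nonpos {α : Type*} [Fintype α] (A : Finset α) {D N : α → Matrix a a ℂ}
    {W T : Matrix a a ℂ} (hW : W.IsHermitian) (hD : ∀ i, (D i).PosSemidef)
    (hN : ∀ i ∈ A, (-N i).PosSemidef) (hN' : ∀ i ∉ A, (N i).PosSemidef)
    (h : (1 / 2 : ℂ) • ((∑ i, D i) * W + W * ∑ i, D i) + Complex.I • (T * W - W * T) = ∑ i, N i) :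
    ∑ i ∈ A, ((N i).trace.re - (D i * W).trace.re) ≤ 0 := by
  obtain ⟨Q, hQ1, hQ, hcomm, hneg, hpos⟩ := exists_negative_projection hW
  -- Pair the equation with `Q`: since `Q` commutes with `W`, the Hamiltonian commutator has zero
  -- trace and both halves of the anticommutator agree.
  have hkey : ∑ i, (D i * (Q * W)).trace.re = ∑ i, (Q * N i).trace.re := by
    have h1 : (Q * ((1 / 2 : ℂ) • ((∑ i, D i) * W + W * ∑ i, D i) +
        Complex.I • (T * W - W * T))).trace = ((∑ i, D i) * (Q * W)).trace := by
      have e1 : ∀ X : Matrix a a ℂ, (Q * (X * W)).trace = (X * (Q * W)).trace := fun X => by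
        rw [Matrix.trace_mul_comm, Matrix.mul_assoc, hcomm]
      have e2 : ∀ X : Matrix a a ℂ, (Q * (W * X)).trace = (X * (Q * W)).trace := fun X => by
        rw [← Matrix.mul_assoc, Matrix.trace_mul_comm]
      rw [Matrix.mul_add, Matrix.mul_smul, Matrix.mul_smul, Matrix.mul_add, Matrix.mul_sub,
        Matrix.trace_add, Matrix.trace_smul, Matrix.trace_smul, Matrix.trace_add,
        Matrix.trace_sub, e1, e1, e2, e2, smul_eq_mul, smul_eq_mul]
      ring
    rw [h] at h1
    rw [← Complex.re_sum, ← Complex.re_sum, ← Matrix.trace_sum, ← Matrix.trace_sum,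
      ← Matrix.sum_mul, ← Matrix.mul_sum, h1]
  have h2 : ∀ i, (D i * (Q * W)).trace.re ≤ (D i * W).trace.re := fun i => by
    have := trace_mul_re_nonneg (hD i) hpos
    rw [Matrix.mul_sub, Matrix.trace_sub, Complex.sub_re] at this
    linarith
  have h3 : ∀ i, (D i * (Q * W)).trace.re ≤ 0 := fun i => by
    have := trace_mul_re_nonneg (hD i) hneg
    rw [Matrix.mul_neg, Matrix.trace_neg, Complex.neg_re] at this
    linarith
  have h4 : ∀ i ∈ A, (N i).trace.re ≤ (Q * N i).trace.re := fun i hi => by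
    have := trace_mul_re_nonneg hQ1 (hN i hi)
    rw [Matrix.mul_neg, Matrix.trace_neg, Complex.neg_re, Matrix.sub_mul, Matrix.one_mul,
      Matrix.trace_sub, Complex.sub_re] at this
    linarith
  have h5 : ∀ i ∉ A, 0 ≤ (Q * N i).trace.re := fun i hi => trace_mul_re_nonneg hQ (hN' i hi)
  classical
  have s1 : ∑ i, (D i * (Q * W)).trace.re ≤ ∑ i ∈ A, (D i * (Q * W)).trace.re := by
    rw [← Finset.sum_add_sum_compl A]
    have := Finset.sum_nonpos (s := Aᶜ) fun i _ => h3 i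
    linarith
  have s2 : ∑ i ∈ A, (Q * N i).trace.re ≤ ∑ i, (Q * N i).trace.re := by
    rw [← Finset.sum_add_sum_compl A]
    have := Finset.sum_nonneg (s := Aᶜ) fun i hi => h5 i (Finset.mem_compl.1 hi)
    linarith
  have s3 := Finset.sum_le_sum fun i (_ : i ∈ A) => h2 i
  have s4 := Finset.sum_le_sum h4
  rw [Finset.sum_sub_distrib]
  linarith

/-- The function `x ↦ x / (1 + e^{-βx})` of a Hermitian matrix. -/
def fermiEnergy (β : ℝ) (κ : Matrix a a ℂ) : Matrix a a ℂ :=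
  cfc (fun x : ℝ => x * (1 + Real.exp (-(β * x)))⁻¹) κ

open scoped Matrix.Norms.L2Operator in
lemma exp_neg_smul_eq_cfc {κ : Matrix a a ℂ} (hκ : κ.IsHermitian) (β : ℝ) :
    NormedSpace.exp (-((β : ℂ) • κ)) = cfc (fun x : ℝ => Real.exp (-(β * x))) κ := by
  have hκ' : IsSelfAdjoint κ := hκ
  have h1 : -((β : ℂ) • κ) = cfc (fun x : ℝ => -(β * x)) κ := by
    rw [cfc_neg, cfc_const_mul β (fun x => x) κ, cfc_id' ℝ κ]
    simp
  have h2 : IsSelfAdjoint (cfc (fun x : ℝ => -(β * x)) κ) := cfc_predicate _ _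
  rw [h1, ← CFC.real_exp_eq_normedSpace_exp h2, ← cfc_comp' Real.exp (fun x => -(β * x)) κ]

lemma fermiEnergy_mul {κ : Matrix a a ℂ} (hκ : κ.IsHermitian) (β : ℝ) :
    fermiEnergy β κ * (1 + NormedSpace.exp (-((β : ℂ) • κ))) = κ := by
  have hκ' : IsSelfAdjoint κ := hκ
  have hc := continuousOn_spectrum κ
  rw [exp_neg_smul_eq_cfc hκ, ← cfc_one ℝ κ (ha := hκ'), ← cfc_add (a := κ) (hf := hc _) (hg := hc _),
    fermiEnergy, ← cfc_mul _ _ κ (hc _) (hc _)]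
  conv_rhs => rw [← cfc_id' ℝ κ (ha := hκ')]
  refine cfc_congr fun x _ => ?_
  simp only [Pi.one_apply]
  have : 1 + Real.exp (-(β * x)) ≠ 0 := by positivity
  field_simp

lemma commute_fermiEnergy {κ X : Matrix a a ℂ} (hκ : κ.IsHermitian) (hX : Commute X κ) (β : ℝ) :
    Commute X (fermiEnergy β κ) :=
  (hX.symm.cfc (by rw [Matrix.star_eq_conjTranspose, hκ.eq]; exact hX.symm) _).symm

lemma fermiEnergy_isHermitian (κ : Matrix a a ℂ) (β : ℝ) : (fermiEnergy β κ).IsHermitian :=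
  cfc_predicate (p := IsSelfAdjoint) _ κ

-- For either sign of x, x / (1 + e^{-βx}) is nondecreasing in β; a product of commuting positive
-- matrices is positive.
open scoped MatrixOrder in
lemma mul_fermiEnergy_sub_posSemidef {κ X : Matrix a a ℂ} (hκ : κ.IsHermitian)
    (hX : X.PosSemidef) (hXκ : Commute X κ) {β γ : ℝ} (h : β ≤ γ) :
    (X * (fermiEnergy γ κ - fermiEnergy β κ)).PosSemidef := by
  have hc := continuousOn_spectrum κ
  rw [← Matrix.nonneg_iff_posSemidef]
  refine Commute.mul_nonneg hX.nonneg ?_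
    ((commute_fermiEnergy hκ hXκ γ).sub_right (commute_fermiEnergy hκ hXκ β))
  rw [fermiEnergy, fermiEnergy, ← cfc_sub _ _ κ (hc _) (hc _)]
  refine cfc_nonneg fun x _ => ?_
  rw [← mul_sub]
  rcases le_total 0 x with hx | hx
  · refine mul_nonneg hx (sub_nonneg.2 ?_)
    gcongr
  · refine mul_nonneg_of_nonpos_of_nonpos hx (sub_nonpos.2 ?_)
    have : γ * x ≤ β * x := mul_le_mul_of_nonpos_right h hx
    gcongr

end Lyapunov

/-! ### Conservation and second law for one-particle fluxes. -/

section OneParticle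

variable {a : Type*} [Fintype a]

/-- The flux of energy into a bath with source `G` and coupling `D`, if the covariance is `R`. -/
def oneParticleFlux (κ R D G : Matrix a a ℂ) : ℂ :=
  (1 / 2 : ℂ) * ((κ * G).trace - (1 / 2 : ℂ) * (D * (κ * R + R * κ)).trace)

lemma oneParticleFlux_im {κ R D G : Matrix a a ℂ} (hκ : κ.IsHermitian) (hR : R.IsHermitian)
    (hD : D.IsHermitian) (hG : G.IsHermitian) : (oneParticleFlux κ R D G).im = 0 := by
  have key : ∀ {X Y : Matrix a a ℂ}, X.IsHermitian → Y.IsHermitian → (X * Y).trace.im = 0 := by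
    intro X Y hX hY
    rw [← Complex.conj_eq_iff_im, starRingEnd_apply, ← Matrix.trace_conjTranspose,
      Matrix.conjTranspose_mul, hX.eq, hY.eq, Matrix.trace_mul_comm]
  have hs : (κ * R + R * κ).IsHermitian := by
    rw [Matrix.IsHermitian, Matrix.conjTranspose_add, Matrix.conjTranspose_mul,
      Matrix.conjTranspose_mul, hκ.eq, hR.eq, add_comm]
  simp [oneParticleFlux, key hκ hG, key hD hs]

variable {α : Type*} [Fintype α] [DecidableEq a] {κ T R : Matrix a a ℂ} {D G : α → Matrix a a ℂ} {β : α → ℝ}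

/-- Multiply the Lyapunov equation by `κ` and take the trace; the Hamiltonian term drops out because
`T` commutes with `κ`. -/
lemma sum_oneParticleFlux (hD : ∀ i, Commute (D i) κ) (hT : Commute T κ)
    (h : (1 / 2 : ℂ) • ((∑ i, D i) * R + R * ∑ i, D i) + Complex.I • (T * R - R * T) =
      ∑ i, G i) :
    ∑ i, oneParticleFlux κ R (D i) (G i) = 0 := by
  have hcomm : Commute (∑ i, D i) κ := Commute.sum_left _ _ _ fun i _ => hD i
  set S := ∑ i, D i with hS
  have h1 : (κ * ∑ i, G i).trace = (1 / 2 : ℂ) * (S * (κ * R + R * κ)).trace := by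
    have e : ∀ X : Matrix a a ℂ, Commute X κ →
        (κ * (X * R)).trace = (X * (κ * R)).trace ∧ (κ * (R * X)).trace = (X * (κ * R)).trace ∧
          (X * (R * κ)).trace = (X * (κ * R)).trace := by
      intro X hX
      have e0 : κ * (X * R) = X * (κ * R) := by rw [← mul_assoc, ← hX.eq, mul_assoc]
      refine ⟨by rw [e0], ?_, ?_⟩
      · rw [← mul_assoc, Matrix.trace_mul_comm]
      · rw [← mul_assoc, Matrix.trace_mul_comm, e0]
    obtain ⟨a1, a2, a3⟩ := e S hcomm
    obtain ⟨b1, b2, -⟩ := e T hT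
    rw [← h, mul_add, mul_smul_comm, mul_smul_comm, mul_add, mul_sub, mul_add, Matrix.trace_add,
      Matrix.trace_smul, Matrix.trace_smul, Matrix.trace_add, Matrix.trace_sub, Matrix.trace_add,
      a1, a2, a3, b1, b2, smul_eq_mul, smul_eq_mul]
    ring
  simp only [oneParticleFlux, ← Finset.mul_sum, Finset.sum_sub_distrib, ← Matrix.trace_sum,
    ← Matrix.sum_mul]
  rw [h1, ← hS, sub_self, mul_zero]

/-- The baths of a set which is hotter than its complement lose energy. -/
lemma sum_oneParticleFlux_nonpos (hκ : κ.IsHermitian) (hR : R.IsHermitian)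
    (hDpos : ∀ i, (D i).PosSemidef) (hD : ∀ i, Commute (D i) κ) (hT : Commute T κ)
    (hG : ∀ i, G i * (1 + NormedSpace.exp (-((β i : ℂ) • κ))) = D i)
    (h : (1 / 2 : ℂ) • ((∑ i, D i) * R + R * ∑ i, D i) + Complex.I • (T * R - R * T) =
      ∑ i, G i) (A : Finset α) (b : ℝ) (hA : ∀ i ∈ A, β i ≤ b) (hA' : ∀ i ∉ A, b ≤ β i) :
    ∑ i ∈ A, (oneParticleFlux κ R (D i) (G i)).re ≤ 0 := by
  have hunit : ∀ i, IsUnit (1 + NormedSpace.exp (-((β i : ℂ) • κ))) := fun i => by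
    refine (Matrix.PosDef.one.add (posDef_exp (Matrix.IsHermitian.neg ?_))).isUnit
    rw [Matrix.IsHermitian, Matrix.conjTranspose_smul, hκ.eq]
    simp
  have hexp : ∀ i, Commute (1 + NormedSpace.exp (-((β i : ℂ) • κ))) κ := fun i => by
    refine (Commute.one_left κ).add_left ?_
    exact (((Commute.refl κ).smul_left (β i : ℂ)).neg_left).exp_left
  have hGκ : ∀ i, κ * G i = D i * fermiEnergy (β i) κ := fun i => by
    refine (hunit i).mul_left_injective ?_
    simp only
    rw [mul_assoc, mul_assoc, hG, fermiEnergy_mul hκ, (hD i).eq]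
  have hGκ' : ∀ i, G i * κ = κ * G i := fun i => by
    refine (hunit i).mul_left_injective ?_
    simp only
    rw [mul_assoc, mul_assoc, hG, ← (hexp i).eq, ← mul_assoc, hG, (hD i).eq]
  set F := fermiEnergy b κ with hF
  have hDF : Commute (∑ i, D i) F :=
    Commute.sum_left _ _ _ fun i _ => commute_fermiEnergy hκ (hD i) b
  have hTF : Commute T F := commute_fermiEnergy hκ hT b
  have hDκ : Commute (∑ i, D i) κ := Commute.sum_left _ _ _ fun i _ => hD i
  -- `κ` need not commute with `R`, so the energy is symmetrized. Subtracting `F` compares it with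
  -- equilibrium at the threshold `b`.
  have hW : ((1 / 2 : ℂ) • (κ * R + R * κ) - F).IsHermitian := by
    refine Matrix.IsHermitian.sub ?_ (fermiEnergy_isHermitian κ b)
    rw [Matrix.IsHermitian, Matrix.conjTranspose_smul, Matrix.conjTranspose_add,
      Matrix.conjTranspose_mul, Matrix.conjTranspose_mul, hκ.eq, hR.eq, add_comm]
    simp
  have hlyap : (1 / 2 : ℂ) • ((∑ i, D i) * ((1 / 2 : ℂ) • (κ * R + R * κ) - F) +
      ((1 / 2 : ℂ) • (κ * R + R * κ) - F) * ∑ i, D i) +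
      Complex.I • (T * ((1 / 2 : ℂ) • (κ * R + R * κ) - F) -
        ((1 / 2 : ℂ) • (κ * R + R * κ) - F) * T) =
      ∑ i, D i * (fermiEnergy (β i) κ - F) := by
    have hs : ∑ i, D i * (fermiEnergy (β i) κ - F) =
        (1 / 2 : ℂ) • (κ * ∑ i, G i + (∑ i, G i) * κ) - (∑ i, D i) * F := by
      simp only [mul_sub, Finset.sum_sub_distrib, Finset.mul_sum, Finset.sum_mul, hGκ', hGκ]
      rw [← two_smul ℂ, smul_smul]
      norm_num
    rw [hs, ← h]
    set S := ∑ i, D i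
    have e1 : S * (κ * R) = κ * (S * R) := by rw [← mul_assoc, hDκ.eq, mul_assoc]
    have e2 : R * κ * S = R * S * κ := by rw [mul_assoc, ← hDκ.eq, mul_assoc]
    have e3 : T * (κ * R) = κ * (T * R) := by rw [← mul_assoc, hT.eq, mul_assoc]
    have e4 : R * κ * T = R * T * κ := by rw [mul_assoc, ← hT.eq, mul_assoc]
    simp only [mul_sub, sub_mul, mul_add, add_mul, mul_smul_comm, smul_mul_assoc, e1, e2, e3, e4,
      ← hDF.eq, ← hTF.eq, mul_assoc]
    module
  have := lyapunov_sum_nonpos A hW hDpos (N := fun i => D i * (fermiEnergy (β i) κ - F))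
    (fun i hi => by
      rw [← mul_neg, neg_sub]
      exact mul_fermiEnergy_sub_posSemidef hκ (hDpos i) (hD i) (hA i hi))
    (fun i hi => mul_fermiEnergy_sub_posSemidef hκ (hDpos i) (hD i) (hA' i hi)) hlyap
  -- The reference terms in `F` cancel, so the net production does not depend on the threshold.
  have h2 : ∑ i ∈ A, ((D i * (fermiEnergy (β i) κ - F)).trace.re -
      (D i * ((1 / 2 : ℂ) • (κ * R + R * κ) - F)).trace.re) =
      2 * ∑ i ∈ A, (oneParticleFlux κ R (D i) (G i)).re := by
    rw [Finset.mul_sum]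
    refine Finset.sum_congr rfl fun i _ => ?_
    rw [← Complex.sub_re, mul_sub, mul_sub, ← hGκ, mul_smul_comm, Matrix.trace_sub,
      Matrix.trace_sub, Matrix.trace_smul, smul_eq_mul]
    have : (κ * G i).trace - (D i * F).trace - ((1 / 2 : ℂ) * (D i * (κ * R + R * κ)).trace -
        (D i * F).trace) = ((2 : ℝ) : ℂ) * oneParticleFlux κ R (D i) (G i) := by
      rw [oneParticleFlux]; push_cast; ring
    rw [this, Complex.re_ofReal_mul]
  linarith

end OneParticle

/-! ### From stationarity to the one-particle equations. -/

namespace ThermalModel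

variable {n : ℕ} (m : ThermalModel n)

/-- The covariance of a stationary state solves a Lyapunov equation. -/
lemma covariance_lyapunov {ρ : m.SysOp} (hρ : m.IsStationaryState ρ) :
    (1 / 2 : ℂ) • ((∑ i, m.Γ i) * covariance ρ + covariance ρ * ∑ i, m.Γ i) +
      Complex.I • (m.TS * covariance ρ - covariance ρ * m.TS) = ∑ i, m.injection i := by
  obtain ⟨⟨-, htr⟩, hst⟩ := hρ
  set R := covariance ρ with hR
  set S := ∑ i, m.Γ i with hS
  set G := ∑ i, m.injection i with hG
  have hTs := swapTranspose_of_isHermitian m.TS_herm m.TS_xi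
  have hRs : swapTranspose R = 1 - R := swapTranspose_covariance htr
  have hGs : swapTranspose G = S - G := by
    simp only [hG, hS, swapTranspose_sum, swapTranspose_injection, Finset.sum_sub_distrib]
  have hSs : swapTranspose S = S := by
    simp only [hS, swapTranspose_sum, swapTranspose_Γ]
  have hcs : swapTranspose (∑ i, m.coupling i) = -(∑ i, m.coupling i)ᴴ := by
    rw [swapTranspose_sum, Matrix.conjTranspose_sum, ← Finset.sum_neg_distrib]
    simp only [swapTranspose_coupling]
  let Y := (S - G) * R + R * (S - G) + Complex.I • (m.TS * R - R * m.TS)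
  have hXY : ∀ X, swapTranspose X = -X → (X * Y).trace = 0 := by
    intro X hX
    have h := hst (quadratic X)
    rw [generator, sum_HSB_eq, mul_add, Matrix.trace_add, m.dissipator_interaction hcs hX,
      sum_coupling_rates, HS, quadratic_commutator_quadratic hTs, mul_smul_comm, Matrix.trace_smul,
      trace_mul_quadratic htr, ← hR, ← hS, ← hG] at h
    have e1 : ((m.TS * X - X * m.TS) * (1 - R)).trace =
        (X * (m.TS * R - R * m.TS)).trace := by
      have c1 : (m.TS * X).trace = (X * m.TS).trace := Matrix.trace_mul_comm _ _
      have c2 : (m.TS * (X * R)).trace = (X * (R * m.TS)).trace := by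
        rw [Matrix.trace_mul_comm, mul_assoc]
      simp only [mul_sub, sub_mul, mul_one, Matrix.trace_sub, mul_assoc, c1, c2]
      ring
    have e2 : ((X * (S - G) + (S - G) * X) * R).trace =
        (X * ((S - G) * R + R * (S - G))).trace := by
      have c : ((S - G) * (X * R)).trace = (X * (R * (S - G))).trace := by
        rw [Matrix.trace_mul_comm, mul_assoc]
      rw [add_mul, mul_add, Matrix.trace_add, Matrix.trace_add, mul_assoc, mul_assoc, c]
    rw [e1, e2, smul_eq_mul] at h
    simp only [Y]
    rw [mul_add, mul_smul_comm, Matrix.trace_add, Matrix.trace_smul, smul_eq_mul]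
    linear_combination 2 * h
  -- Quadratic observables see only the antisymmetric part of `Y`. Equating `Y` with its transpose
  -- cancels the terms quadratic in `R` and `G` and leaves a linear equation.
  have hY : Y = swapTranspose Y := by
    rw [Matrix.ext_iff_trace_mul_left]
    intro Z
    have h := hXY (Z - swapTranspose Z)
      (by rw [swapTranspose_sub, swapTranspose_swapTranspose, neg_sub])
    rw [sub_mul, Matrix.trace_sub, sub_eq_zero] at h
    rw [h, ← trace_swapTranspose, swapTranspose_mul, swapTranspose_swapTranspose,
      Matrix.trace_mul_comm]
  have hYs : swapTranspose Y =
      (1 - R) * G + G * (1 - R) - Complex.I • (m.TS * R - R * m.TS) := by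
    simp only [Y, swapTranspose_add, swapTranspose_smul, swapTranspose_sub, swapTranspose_mul,
      hTs, hRs, hGs, hSs, sub_sub_cancel]
    rw [sub_eq_add_neg ((1 - R) * G + G * (1 - R)), ← smul_neg]
    congr 2
    noncomm_ring
  rw [hYs] at hY
  simp only [Y, mul_sub, sub_mul, one_mul, mul_one] at hY
  have h2 : (2 : ℂ) • ((1 / 2 : ℂ) • (S * R + R * S) +
      Complex.I • (m.TS * R - R * m.TS)) = (2 : ℂ) • G := by
    rw [← sub_eq_zero] at hY ⊢
    rw [← hY]
    module
  exact smul_right_injective _ two_ne_zero h2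

lemma flux_eq {ρ : m.SysOp} (hρ : ρ.trace = 1) (i : Fin n) :
    m.flux ρ i = oneParticleFlux m.κS (covariance ρ) (m.Γ i) (m.injection i) := by
  have hκs := swapTranspose_of_isHermitian m.κS_herm m.κS_xi
  rw [flux, HSB_eq, KS, m.dissipator_interaction (m.swapTranspose_coupling i) hκs, coupling_rates,
    oneParticleFlux]
  set R := covariance ρ with hR
  set D := m.Γ i with hD
  set G := m.injection i with hG
  -- The trace is invariant under transposition; comparing the two expressions eliminates tr(G{κ,
  -- R}).
  have h1 : ((m.κS * (D - G) + (D - G) * m.κS) * R).trace =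
      -((1 - R) * (G * m.κS + m.κS * G)).trace := by
    rw [← trace_swapTranspose, swapTranspose_mul, swapTranspose_add, swapTranspose_mul,
      swapTranspose_mul, swapTranspose_sub, swapTranspose_Γ, swapTranspose_injection, hκs,
      swapTranspose_covariance hρ, ← Matrix.trace_neg]
    congr 1
    noncomm_ring
  have c1 : (m.κS * (D * R)).trace = (D * (R * m.κS)).trace := by
    rw [Matrix.trace_mul_comm, mul_assoc]
  have c2 : (m.κS * (G * R)).trace = (R * (m.κS * G)).trace := by
    rw [← mul_assoc, Matrix.trace_mul_comm]
  have c3 : (G * (m.κS * R)).trace = (R * (G * m.κS)).trace := by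
    rw [← mul_assoc, Matrix.trace_mul_comm]
  have c4 : (G * m.κS).trace = (m.κS * G).trace := Matrix.trace_mul_comm _ _
  simp only [mul_sub, sub_mul, mul_add, add_mul, one_mul, mul_assoc, Matrix.trace_sub,
    Matrix.trace_add, c1, c2, c3, c4] at h1 ⊢
  linear_combination (-1 / 4 : ℂ) * h1

/-- Reality, conservation and second law for the stationary fluxes. -/
lemma stationary_flux {ρ : m.SysOp} (hρ : m.IsStationaryState ρ) :
    (∀ i, (m.flux ρ i).im = 0) ∧ ∑ i, m.flux ρ i = 0 ∧
      ∀ (A : Finset (Fin n)) (b : ℝ), (∀ i ∈ A, m.β i ≤ b) → (∀ i ∉ A, b ≤ m.β i) →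
        ∑ i ∈ A, (m.flux ρ i).re ≤ 0 := by
  have hR : (covariance ρ).IsHermitian := covariance_isHermitian hρ.1.1.isHermitian
  have hl := m.covariance_lyapunov hρ
  have hT : Commute m.TS m.κS := m.conserved_S
  simp only [m.flux_eq hρ.1.2]
  refine ⟨fun i => oneParticleFlux_im m.κS_herm hR (m.Γ_posSemidef i).isHermitian
    (m.injection_isHermitian i), sum_oneParticleFlux m.commute_Γ_κS hT hl, ?_⟩
  intro A b hA hA'
  exact sum_oneParticleFlux_nonpos m.κS_herm hR m.Γ_posSemidef m.commute_Γ_κS hT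
    m.injection_mul hl A b hA hA'

end ThermalModel

/-! ### Combinatorics of pair decompositions. -/

section PairDecomposition

variable {n : ℕ} {β J : Fin n → ℝ}

/-- Every set of baths which is hotter than its complement loses energy. -/
def HotSetsLose (β J : Fin n → ℝ) : Prop :=
  ∀ (A : Finset (Fin n)) (b : ℝ), (∀ i ∈ A, β i ≤ b) → (∀ i ∉ A, b ≤ β i) → ∑ i ∈ A, J i ≤ 0

/-- Exchanges inside `A` cancel by antisymmetry, and each exchange across its boundary flows out of
`A`. -/
lemma IsPairDecomposition.hotSetsLose {P : Fin n → Fin n → ℝ} (h : IsPairDecomposition β J P) :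
    HotSetsLose β J := by
  obtain ⟨h1, h2, h3⟩ := h
  intro A b hA hA'
  simp only [h3]
  have hself : ∑ i ∈ A, ∑ j ∈ A, P i j = 0 := by
    have : ∑ i ∈ A, ∑ j ∈ A, P i j = -∑ i ∈ A, ∑ j ∈ A, P i j := by
      conv_lhs => rw [Finset.sum_comm]
      simp only [← Finset.sum_neg_distrib]
      exact Finset.sum_congr rfl fun i _ => Finset.sum_congr rfl fun j _ => h1 i j
    linarith
  have hsplit : ∑ i ∈ A, ∑ j, P i j = ∑ i ∈ A, ∑ j ∈ A, P i j + ∑ i ∈ A, ∑ j ∈ Aᶜ, P i j := by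
    rw [← Finset.sum_add_distrib]
    exact Finset.sum_congr rfl fun i _ => (Finset.sum_add_sum_compl A _).symm
  rw [hsplit, hself, zero_add]
  refine Finset.sum_nonpos fun i hi => Finset.sum_nonpos fun j hj => ?_
  have := h2 j i ((hA i hi).trans (hA' j (Finset.mem_compl.1 hj)))
  rw [h1 i j] at this
  linarith

/-- A transfer from the hot bath `q` to the colder bath `p` as a pair decomposition. -/
lemma isPairDecomposition_transfer {p q : Fin n} (hpq : β q < β p) {δ : ℝ} (hδ : 0 ≤ δ) :
    IsPairDecomposition β (fun i => (if i = p then δ else 0) - if i = q then δ else 0)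
      (fun i j => (if i = p ∧ j = q then δ else 0) - if i = q ∧ j = p then δ else 0) := by
  have hne : p ≠ q := fun h => by rw [h] at hpq; exact lt_irrefl _ hpq
  refine ⟨fun i j => ?_, fun i j hij => ?_, fun i => ?_⟩
  · simp only [and_comm (a := j = p), and_comm (a := j = q)]
    ring
  · have : ¬ (i = q ∧ j = p) := by
      rintro ⟨rfl, rfl⟩; exact absurd hij (not_le.2 hpq)
    simp only [this, if_false, sub_zero]
    split_ifs <;> simp [hδ]
  · simp only [Finset.sum_sub_distrib, ite_and]
    by_cases h1 : i = p <;> by_cases h2 : i = q <;> simp [h1, h2]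

lemma IsPairDecomposition.add {J' : Fin n → ℝ} {P P' : Fin n → Fin n → ℝ}
    (h : IsPairDecomposition β J P) (h' : IsPairDecomposition β J' P') :
    IsPairDecomposition β (J + J') (P + P') := by
  refine ⟨fun i j => ?_, fun i j hij => ?_, fun i => ?_⟩
  · simp only [Pi.add_apply, h.1 i j, h'.1 i j]; ring
  · exact add_nonneg (h.2.1 i j hij) (h'.2.1 i j hij)
  · simp only [Pi.add_apply, h.2.2 i, h'.2.2 i, Finset.sum_add_distrib]

/-- Greedy matching: the hottest gaining bath is fed by a strictly hotter losing bath, and the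
number of nonzero fluxes drops at each transfer. -/
lemma HotSetsLose.exists_isPairDecomposition (h0 : ∑ i, J i = 0) (h : HotSetsLose β J) :
    ∃ P : Fin n → Fin n → ℝ, IsPairDecomposition β J P := by
  induction hN : (Finset.univ.filter fun i => J i ≠ 0).card using Nat.strong_induction_on
    generalizing J with
  | _ N ih =>
  by_cases hpos : ∃ i, 0 < J i
  swap
  · push Not at hpos
    have hz : ∀ i, J i = 0 := fun i =>
      (Finset.sum_eq_zero_iff_of_nonpos fun i _ => hpos i).1 h0 i (Finset.mem_univ i)
    exact ⟨0, by simp, by simp, by simp [hz]⟩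
  obtain ⟨p, hp, hpmin⟩ : ∃ p, 0 < J p ∧ ∀ i, 0 < J i → β p ≤ β i := by
    obtain ⟨i, hi⟩ := hpos
    obtain ⟨p, hp, hmin⟩ := (Finset.univ.filter fun i => 0 < J i).exists_min_image β
      ⟨i, by simpa using hi⟩
    exact ⟨p, by simpa using hp, fun i hi => hmin i (by simpa using hi)⟩
  -- Otherwise `p` together with all strictly hotter baths would be a hot set with positive total.
  obtain ⟨q, hqp, hq⟩ : ∃ q, β q < β p ∧ J q < 0 := by
    by_contra hcon
    push Not at hcon
    have h1 := h (insert p (Finset.univ.filter fun i => β i < β p)) (β p)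
      (by
        intro i hi
        rcases Finset.mem_insert.1 hi with rfl | hi
        · exact le_rfl
        · exact (by simpa using hi : β i < β p).le)
      (by
        intro i hi
        simp only [Finset.mem_insert, Finset.mem_filter, Finset.mem_univ, true_and, not_or,
          not_lt] at hi
        exact hi.2)
    rw [Finset.sum_insert (by simp)] at h1
    have h2 : 0 ≤ ∑ i ∈ Finset.univ.filter (fun i => β i < β p), J i :=
      Finset.sum_nonneg fun i hi => hcon i (by simpa using hi)
    linarith
  have hne : p ≠ q := fun h => by rw [h] at hqp; exact lt_irrefl _ hqp
  set δ := min (J p) (-J q) with hδ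
  have hδ0 : 0 < δ := lt_min hp (by linarith)
  have hδp : δ ≤ J p := min_le_left _ _
  have hδq : δ ≤ -J q := min_le_right _ _
  let t : Fin n → ℝ := fun i => (if i = p then δ else 0) - if i = q then δ else 0
  have hts : ∀ A : Finset (Fin n), ∑ i ∈ A, t i =
      (if p ∈ A then δ else 0) - if q ∈ A then δ else 0 := by
    intro A
    simp [t, Finset.sum_sub_distrib]
  have h0' : ∑ i, (J - t) i = 0 := by
    simp only [Pi.sub_apply, Finset.sum_sub_distrib, h0, hts]
    simp
  have hhot : HotSetsLose β (J - t) := by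
    intro A b hA hA'
    simp only [Pi.sub_apply, Finset.sum_sub_distrib, hts]
    have hJA := h A b hA hA'
    by_cases hpA : p ∈ A
    · by_cases hqA : q ∈ A <;> simp only [hpA, hqA, if_true, if_false] <;> linarith
    by_cases hqA : q ∈ A
    swap
    · simp only [hpA, hqA, if_false]; linarith
    simp only [hpA, hqA, if_true, if_false]
    suffices ∑ i ∈ A, J i ≤ -δ by linarith
    -- Only sets containing `q` but not `p` are at risk. If `A` contains a gainer, minimality of `β
    -- p` forces the threshold to be `β p`, so adding `p` keeps the set hot. If not, `q` alone gives
    -- the bound.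
    by_cases hAp : ∃ i ∈ A, 0 < J i
    · obtain ⟨i, hiA, hi⟩ := hAp
      have hb : b = β p := le_antisymm (hA' p hpA) ((hpmin i hi).trans (hA i hiA))
      have := h (insert p A) b
        (by
          intro j hj
          rcases Finset.mem_insert.1 hj with rfl | hj
          · exact hb.ge
          · exact hA j hj)
        (fun j hj => hA' j fun hjA => hj (Finset.mem_insert_of_mem hjA))
      rw [Finset.sum_insert hpA] at this
      linarith
    · push Not at hAp
      rw [← Finset.add_sum_erase A J hqA]
      have := Finset.sum_nonpos (s := A.erase q) fun i hi => hAp i (Finset.mem_of_mem_erase hi)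
      linarith
  have hcard : (Finset.univ.filter fun i => (J - t) i ≠ 0).card < N := by
    rw [← hN]
    refine Finset.card_lt_card (Finset.ssubset_iff_subset_ne.2 ⟨?_, ?_⟩)
    · intro i hi
      simp only [Finset.mem_filter, Finset.mem_univ, true_and] at hi ⊢
      intro hJi
      have hip : i ≠ p := fun h => by rw [h] at hJi; linarith
      have hiq : i ≠ q := fun h => by rw [h] at hJi; linarith
      exact hi (by simp [t, hip, hiq, hJi])
    · intro heq
      -- The choice of `δ` as a minimum makes the flux vanish at `p` or at `q`, where it was
      -- nonzero.
      rcases min_choice (J p) (-J q) with hm | hm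
      · have : p ∈ Finset.univ.filter fun i => (J - t) i ≠ 0 := by rw [heq]; simp [hp.ne']
        simp [t, hne, hδ, hm] at this
      · have : q ∈ Finset.univ.filter fun i => (J - t) i ≠ 0 := by rw [heq]; simp [hq.ne]
        simp [t, hne.symm, hδ, hm] at this
  obtain ⟨P, hP⟩ := ih _ hcard h0' hhot rfl
  have hadd : IsPairDecomposition β (J - t + t) _ :=
    hP.add (isPairDecomposition_transfer hqp hδ0.le)
  rw [sub_add_cancel] at hadd
  exact ⟨_, hadd⟩

lemma HotSetsLose.sum_Iic_nonpos (h : HotSetsLose β J) (σ : Equiv.Perm (Fin n))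
    (hσ : Monotone fun i => β (σ i)) (k : Fin n) : ∑ i ∈ Finset.Iic k, J (σ i) ≤ 0 := by
  have := h ((Finset.Iic k).map σ.toEmbedding) (β (σ k))
    (by
      intro i hi
      obtain ⟨j, hj, rfl⟩ := Finset.mem_map.1 hi
      exact hσ (Finset.mem_Iic.1 hj))
    (by
      intro i hi
      obtain ⟨j, rfl⟩ := σ.surjective i
      refine hσ (le_of_lt (not_le.1 fun hjk => hi ?_))
      exact Finset.mem_map.2 ⟨j, Finset.mem_Iic.2 hjk, rfl⟩)
  rwa [Finset.sum_map] at this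

/-- Baths tied at the threshold may lie on either side of `A`, so the ordering must be adapted to
`A`; this is why all compatible permutations are needed. -/
lemma hotSetsLose_of_sum_Iic_nonpos
    (h : ∀ σ : Equiv.Perm (Fin n), Monotone (fun i => β (σ i)) →
      ∀ k : Fin n, ∑ i ∈ Finset.Iic k, J (σ i) ≤ 0) : HotSetsLose β J := by
  intro A b hA hA'
  rcases A.eq_empty_or_nonempty with rfl | hne
  · simp
  -- The second coordinate breaks ties in favour of `A`, which makes `A` an initial segment of the
  -- sorted baths.
  let f : Fin n → ℝ ×ₗ ℕ := fun i => toLex (β i, if i ∈ A then 0 else 1)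
  set σ := Tuple.sort f with hσdef
  have hmono : Monotone (f ∘ σ) := Tuple.monotone_sort f
  have hβ : Monotone fun i => β (σ i) := fun i j hij => by
    rcases Prod.Lex.le_iff.1 (hmono hij) with h1 | h1
    · exact h1.le
    · exact h1.1.le
  have hdown : ∀ i j, i ≤ j → σ j ∈ A → σ i ∈ A := by
    intro i j hij hj
    by_contra hi
    have hb : β (σ j) ≤ β (σ i) := (hA _ hj).trans (hA' _ hi)
    rcases Prod.Lex.le_iff.1 (hmono hij) with h1 | h1
    · exact absurd h1 (not_lt.2 hb)
    · simp [f, hi, hj] at h1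
  set B := A.map σ.symm.toEmbedding with hB
  have hBmem : ∀ i, i ∈ B ↔ σ i ∈ A := fun i => by simp [hB, Finset.mem_map_equiv]
  have hBne : B.Nonempty := hne.map
  have hBI : B = Finset.Iic (B.max' hBne) := by
    ext i
    rw [Finset.mem_Iic]
    refine ⟨fun hi => B.le_max' i hi, fun hi => ?_⟩
    exact (hBmem i).2 (hdown i _ hi ((hBmem _).1 (B.max'_mem hBne)))
  have hk := h σ hβ (B.max' hBne)
  rw [← hBI, hB, Finset.sum_map] at hk
  simpa using hk

end PairDecomposition

end QuasiFree

end

theorem mainTheorem1 {n : ℕ} (m : QuasiFree.ThermalModel n) (ρ : m.SysOp)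
    (hρ : m.IsStationaryState ρ) :
    -- the stationary fluxes are real and split into hot-to-cold fluxes between pairs of baths
    (∃ J : Fin n → ℝ, (∀ i, m.flux ρ i = (J i : ℂ)) ∧
      (∃ P : Fin n → Fin n → ℝ, QuasiFree.IsPairDecomposition m.β J P) ∧
      ∑ i, J i = 0 ∧
      (Monotone m.β → ∀ k : Fin n, ∑ i ∈ Finset.Iic k, J i ≤ 0) ∧
      (∀ i, (∀ j, m.β j ≤ m.β i) → 0 ≤ J i)) ∧
    -- equivalence of the two forms, for all families of real fluxes of zero sum
    (∀ J : Fin n → ℝ, ∑ i, J i = 0 →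
      ((∃ P : Fin n → Fin n → ℝ, QuasiFree.IsPairDecomposition m.β J P) ↔
        ∀ σ : Equiv.Perm (Fin n), Monotone (fun i => m.β (σ i)) →
          ∀ k : Fin n, ∑ i ∈ Finset.Iic k, J (σ i) ≤ 0)) := by
  constructor
  · obtain ⟨him, hsum, hhot⟩ := m.stationary_flux hρ
    have h0 : ∑ i, (m.flux ρ i).re = 0 := by rw [← Complex.re_sum, hsum, Complex.zero_re]
    have hlose : QuasiFree.HotSetsLose m.β fun i => (m.flux ρ i).re := hhot
    obtain ⟨P, hP⟩ := hlose.exists_isPairDecomposition h0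
    refine ⟨fun i => (m.flux ρ i).re, fun i => Complex.ext (by simp) (by simp [him]), ⟨P, hP⟩, h0,
      fun hmono k => hlose.sum_Iic_nonpos 1 hmono k, fun i hi => ?_⟩
    -- A coldest bath receives a nonnegative amount from every other one.
    rw [hP.2.2 i]
    exact Finset.sum_nonneg fun j _ => hP.2.1 i j (hi j)
  · intro J h0
    refine ⟨fun ⟨P, hP⟩ σ hσ k => hP.hotSetsLose.sum_Iic_nonpos σ hσ k, fun h => ?_⟩
    exact (QuasiFree.hotSetsLose_of_sum_Iic_nonpos h).exists_isPairDecomposition h0
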